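/- Let $n\ge 0$ be an integer and let $\overline{Q}$ be the doubled star-shaped quiver with vertices $0,1,\dots,n$ and arrows $a_i\colon 0\to i$, $a_i^*\colon i\to 0$ $(1\le i\le n)$. Put $\boldsymbol{v}=(2,1,\dots,1)$, $V_0=\mathbb{C}^2$, $V_i=\mathbb{C}$ for $i\geq 1$, and $$\mathrm{Rep}(\overline{Q},\boldsymbol{v})=\bigoplus_{i=1}^n \mathrm{Hom}(V_0,V_i)\oplus\bigoplus_{i=1}^n\mathrm{Hom}(V_i,V_0),$$ on which $\mathrm{GL}_{\boldsymbol{v}}=\mathrm{GL}_2\times(\mathbb{C}^\times)^n$ acts by $g\cdot(B_{a_i},B_{a_i^*})=(g_iB_{a_i}g_0^{-1},\,g_0B_{a_i^*}g_i^{-1})$; $\mathrm{SL}_2$ acts through the factor $\mathrm{GL}_2$. Let $$\mu(B)=\Big(\sum_{i=1}^n B_{a_i^*}B_{a_i},\,-B_{a_1}B_{a_1^*},\dots,-B_{a_n}B_{a_n^*}\Big)\in\mathfrak{gl}_2\oplus\mathbb{C}^n .$$ Let $\lambda=(\lambda_0,\dots,\lambda_n)\in\mathbb{C}^{n+1}$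 satisfy $\lambda\cdot\boldsymbol{v}=2\lambda_0+\sum_{i=1}^n\lambda_i=0$, and let $\mu^{-1}(\lambda)$ be the scheme-theoretic fibre of $\mu$ over $(\lambda_0\mathrm{Id},\lambda_1,\dots,\lambda_n)$. Let $\omega(u,w)=u_1w_2-u_2w_1$ be the standard symplectic form on $V_0$, and identify $V_0\cong V_0^*$ by $u\mapsto\omega(u,-)$. For each arrow $a$ this makes the evaluation $\mathrm{ev}_a\colon B\mapsto B_a$ a $V_0$-valued function on $\mathrm{Rep}(\overline{Q},\boldsymbol{v})$. Put $\varphi_{a,b}=\omega(\mathrm{ev}_a,\mathrm{ev}_b)$ for $a,b\in\overline{Q}_1=\{a_1,\dots,a_n,a_1^*,\dots,a_n^*\}$. Then: (i) The ring $\mathbb{C}[\mathrm{Rep}(\overline{Q},\boldsymbol{v})]^{\mathrm{SL}_2}$ is generated as a $\mathbb{C}$-algebra by the $\varphi_{a,b}$, and the ideal of all polynomial relations among them is generated by the relations $\varphi_{a,b}+\varphi_{b,a}=0$ and $\varphi_{a,b}\varphi_{c,d}-\varphi_{a,c}\varphi_{b,d}+\varphi_{a,d}\varphi_{b,c}=0$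 for $a,b,c,d\in\overline{Q}_1$. (ii) The restriction map $\mathbb{C}[\mathrm{Rep}(\overline{Q},\boldsymbol{v})]^{\mathrm{SL}_2}\to\mathbb{C}[\mu^{-1}(\lambda)]^{\mathrm{SL}_2}$ is surjective, and its kernel is the ideal of $\mathbb{C}[\mathrm{Rep}(\overline{Q},\boldsymbol{v})]^{\mathrm{SL}_2}$ generated by the elements $\varphi_{a_i,a_i^*}+\lambda_i$ for $1\le i\le n$ and $\sum_{i=1}^n\varphi_{a_i,b}\,\varphi_{a_i^*,c}-\lambda_0\varphi_{b,c}$ for $b,c\in\overline{Q}_1$. (iii) The subring $\mathbb{C}[\mu^{-1}(\lambda)]^{\mathrm{GL}_{\boldsymbol{v}}}$ is the linear span of (the restrictions of) those monomials in the $\varphi_{a,b}$ in which, for every $i$, the total number of occurrences of the index $a_i$ equals that of $a_i^*$. -/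

import Mathlib

namespace Hyperpolygon

/-- The arrows of the doubled star-shaped quiver with central vertex `0` and external vertices
`1, …, n`: `Sum.inl i` is the arrow `a_i` from `0` to the `i`-th external vertex, and
`Sum.inr i` is the reversed arrow `a_i^*`. -/
abbrev Arrow (n : ℕ) : Type := Fin n ⊕ Fin n

/-- Representations of the doubled quiver of dimension vector `(2, 1, …, 1)`, with coefficients in
`R`: `B i` is the matrix of the arrow `a_i` and `Bstar i` is the matrix of `a_i^*`. -/
structure QuiverRep (n : ℕ) (R : Type) where
  B : Fin n → Matrix (Fin 1) (Fin 2) R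
  Bstar : Fin n → Matrix (Fin 2) (Fin 1) R

/-- The coordinate ring of the affine space of representations: one variable for each matrix
entry of each arrow. -/
abbrev CoordRing (n : ℕ) : Type := MvPolynomial (Arrow n × Fin 2) ℂ

/-- The coordinates of a representation. -/
def QuiverRep.coord {n : ℕ} {R : Type} (V : QuiverRep n R) : Arrow n × Fin 2 → R
  | (Sum.inl i, k) => V.B i 0 k
  | (Sum.inr i, k) => V.Bstar i k 0

/-- The universal representation, whose matrix entries are the coordinate functions. -/
noncomputable def generic (n : ℕ) : QuiverRep n (CoordRing n) where
  B i := Matrix.of fun _ k => MvPolynomial.X (Sum.inl i, k)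
  Bstar i := Matrix.of fun k _ => MvPolynomial.X (Sum.inr i, k)

/-- The group `GL_v = GL_2 × (ℂ^×)^n`. -/
abbrev GLv (n : ℕ) : Type := GL (Fin 2) ℂ × (Fin n → ℂˣ)

/-- The action `g · (B_{a_i}, B_{a_i^*}) = (g_i B_{a_i} g_0⁻¹, g_0 B_{a_i^*} g_i⁻¹)`, on
representations with coefficients in any commutative `ℂ`-algebra. -/
noncomputable def act {n : ℕ} {R : Type} [CommRing R] [Algebra ℂ R] (g : GLv n)
    (V : QuiverRep n R) : QuiverRep n R where
  B i := (g.2 i : ℂ) • (V.B i * ((g.1⁻¹ : GL (Fin 2) ℂ) : Matrix (Fin 2) (Fin 2) ℂ).map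
    (algebraMap ℂ R))
  Bstar i := (((g.2 i)⁻¹ : ℂˣ) : ℂ) •
    ((g.1 : Matrix (Fin 2) (Fin 2) ℂ).map (algebraMap ℂ R) * V.Bstar i)

/-- The inclusion of `SL_2` in `GL_v` through the central vertex. -/
noncomputable def slIncl (n : ℕ) (h : Matrix.SpecialLinearGroup (Fin 2) ℂ) : GLv n :=
  (Matrix.SpecialLinearGroup.toGL h, 1)

/-- The action of `g ∈ GL_v` on functions, `(g · f)(V) = f (g⁻¹ · V)`. -/
noncomputable def coordAct {n : ℕ} (g : GLv n) : CoordRing n →ₐ[ℂ] CoordRing n :=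
  MvPolynomial.aeval (act g⁻¹ (generic n)).coord

/-- The component at the central vertex of the moment map. -/
def momentCentral {n : ℕ} {R : Type} [CommRing R] (V : QuiverRep n R) :
    Matrix (Fin 2) (Fin 2) R :=
  ∑ i, V.Bstar i * V.B i

/-- The component at the `i`-th external vertex of the moment map. -/
def momentExternal {n : ℕ} {R : Type} [CommRing R] (V : QuiverRep n R) (i : Fin n) :
    Matrix (Fin 1) (Fin 1) R :=
  -(V.B i * V.Bstar i)

/-- The component of `μ - λ` at the central vertex, where `λ_0 ∈ ℂ` stands for the scalar matrix
`λ_0 Id` in `gl_2`. -/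
noncomputable def centralDefect (n : ℕ) (lam : Fin (n + 1) → ℂ) :
    Matrix (Fin 2) (Fin 2) (CoordRing n) :=
  momentCentral (generic n) - Matrix.scalar (Fin 2) (MvPolynomial.C (lam 0))

/-- The component of `μ - λ` at the `i`-th external vertex. -/
noncomputable def externalDefect (n : ℕ) (lam : Fin (n + 1) → ℂ) (i : Fin n) :
    Matrix (Fin 1) (Fin 1) (CoordRing n) :=
  momentExternal (generic n) i - Matrix.scalar (Fin 1) (MvPolynomial.C (lam i.succ))

/-- The ideal of the scheme-theoretic fibre `μ⁻¹(λ)` over the central element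
`(λ_0 Id, λ_1, …, λ_n)`: it is generated by the matrix entries of `μ - λ`. -/
noncomputable def momentIdeal (n : ℕ) (lam : Fin (n + 1) → ℂ) : Ideal (CoordRing n) :=
  Ideal.span
    ({f | ∃ k l : Fin 2, f = centralDefect n lam k l} ∪
     {f | ∃ i : Fin n, f = externalDefect n lam i 0 0})

/-- The coordinate ring `ℂ[μ⁻¹(λ)]`. -/
abbrev FibreRing (n : ℕ) (lam : Fin (n + 1) → ℂ) : Type := CoordRing n ⧸ momentIdeal n lam

theorem map_generic_coord {n : ℕ} {R : Type} [CommRing R] [Algebra ℂ R] (V : QuiverRep n R) :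
    (∀ i k, MvPolynomial.aeval V.coord ((generic n).B i 0 k) = V.B i 0 k) ∧
    (∀ i k, MvPolynomial.aeval V.coord ((generic n).Bstar i k 0) = V.Bstar i k 0) := by
  constructor <;> intro i k <;> simp [generic, QuiverRep.coord]

/-- The action on functions is the one induced by the action on representations. -/
theorem aeval_coordAct {n : ℕ} (g : GLv n) (V : QuiverRep n ℂ) (f : CoordRing n) :
    MvPolynomial.aeval V.coord (coordAct g f) = MvPolynomial.aeval (act g⁻¹ V).coord f := by
  have h : (MvPolynomial.aeval V.coord).comp (coordAct g) =
      (MvPolynomial.aeval (act g⁻¹ V).coord : CoordRing n →ₐ[ℂ] ℂ) := by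
    apply MvPolynomial.algHom_ext
    rintro ⟨i | i, k⟩ <;>
      simp [coordAct, act, generic, QuiverRep.coord, Matrix.mul_apply, Fin.sum_univ_two] <;>
      ring
  exact DFunLike.congr_fun h f

theorem coordAct_momentCentral {n : ℕ} (g : GLv n) :
    (momentCentral (generic n)).map (coordAct g) =
      ((g.1⁻¹ : GL (Fin 2) ℂ) : Matrix (Fin 2) (Fin 2) ℂ).map (algebraMap ℂ (CoordRing n)) *
        momentCentral (generic n) *
        (g.1 : Matrix (Fin 2) (Fin 2) ℂ).map (algebraMap ℂ (CoordRing n)) := by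
  have h1 : ∀ i, ((generic n).B i).map (coordAct g) = (act g⁻¹ (generic n)).B i := by
    intro i
    refine Matrix.ext fun k l => ?_
    rw [Subsingleton.elim k 0]
    exact (map_generic_coord (act g⁻¹ (generic n))).1 i l
  have h2 : ∀ i, ((generic n).Bstar i).map (coordAct g) = (act g⁻¹ (generic n)).Bstar i := by
    intro i
    refine Matrix.ext fun k l => ?_
    rw [Subsingleton.elim l 0]
    exact (map_generic_coord (act g⁻¹ (generic n))).2 i k
  have h3 : (momentCentral (generic n)).map (coordAct g) =
      ∑ i, ((generic n).Bstar i).map (coordAct g) * ((generic n).B i).map (coordAct g) := by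
    refine Matrix.ext fun k l => ?_
    simp [momentCentral, Matrix.sum_apply, Matrix.mul_apply]
  rw [h3, momentCentral, Matrix.mul_sum, Matrix.sum_mul]
  refine Finset.sum_congr rfl fun i _ => ?_
  rw [h1, h2]
  simp [act, smul_smul, Matrix.mul_assoc]

theorem coordAct_momentExternal {n : ℕ} (g : GLv n) (i : Fin n) :
    coordAct g (momentExternal (generic n) i 0 0) = momentExternal (generic n) i 0 0 := by
  have h1 : ((generic n).B i).map (coordAct g) = (act g⁻¹ (generic n)).B i := by
    refine Matrix.ext fun k l => ?_
    rw [Subsingleton.elim k 0]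
    exact (map_generic_coord (act g⁻¹ (generic n))).1 i l
  have h2 : ((generic n).Bstar i).map (coordAct g) = (act g⁻¹ (generic n)).Bstar i := by
    refine Matrix.ext fun k l => ?_
    rw [Subsingleton.elim l 0]
    exact (map_generic_coord (act g⁻¹ (generic n))).2 i k
  have h3 : coordAct g (momentExternal (generic n) i 0 0) =
      (-(((generic n).B i).map (coordAct g) * ((generic n).Bstar i).map (coordAct g))) 0 0 := by
    simp [momentExternal, Matrix.mul_apply]
  have h4 : (g.1 : Matrix (Fin 2) (Fin 2) ℂ).map (algebraMap ℂ (CoordRing n)) *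
      ((g.1⁻¹ : GL (Fin 2) ℂ) : Matrix (Fin 2) (Fin 2) ℂ).map (algebraMap ℂ (CoordRing n)) = 1 := by
    rw [← Matrix.map_mul, ← Units.val_mul, mul_inv_cancel]
    exact Matrix.map_one _ (map_zero _) (map_one _)
  have h5 : (act g⁻¹ (generic n)).B i * (act g⁻¹ (generic n)).Bstar i =
      (generic n).B i * (generic n).Bstar i := by
    simp only [act, Prod.fst_inv, Prod.snd_inv, inv_inv, Pi.inv_apply, Matrix.smul_mul,
      Matrix.mul_smul, smul_smul]
    rw [Matrix.mul_assoc, ← Matrix.mul_assoc _ _ ((generic n).Bstar i), h4, Matrix.one_mul]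
    simp
  rw [h3, h1, h2, h5, momentExternal]

/-- The fibre over a central element is stable under `GL_v`. -/
theorem momentIdeal_le_comap {n : ℕ} (lam : Fin (n + 1) → ℂ) (g : GLv n) :
    momentIdeal n lam ≤ (momentIdeal n lam).comap (coordAct g) := by
  rw [momentIdeal, Ideal.span_le]
  rintro f (⟨k, l, rfl⟩ | ⟨i, rfl⟩)
  · have h4 : ((g.1⁻¹ : GL (Fin 2) ℂ) : Matrix (Fin 2) (Fin 2) ℂ).map
        (algebraMap ℂ (CoordRing n)) *
        (g.1 : Matrix (Fin 2) (Fin 2) ℂ).map (algebraMap ℂ (CoordRing n)) = 1 := by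
      rw [← Matrix.map_mul, ← Units.val_mul, inv_mul_cancel]
      exact Matrix.map_one _ (map_zero _) (map_one _)
    have key : coordAct g (centralDefect n lam k l) =
        (((g.1⁻¹ : GL (Fin 2) ℂ) : Matrix (Fin 2) (Fin 2) ℂ).map (algebraMap ℂ (CoordRing n)) *
        centralDefect n lam *
        (g.1 : Matrix (Fin 2) (Fin 2) ℂ).map (algebraMap ℂ (CoordRing n))) k l := by
      rw [centralDefect, Matrix.mul_sub, Matrix.sub_mul, ← coordAct_momentCentral,
        ← (Matrix.scalar_commute (MvPolynomial.C (lam 0)) (fun r => Commute.all _ r) _).eq,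
        Matrix.mul_assoc, h4, Matrix.mul_one, Matrix.sub_apply, Matrix.sub_apply, map_sub,
        Matrix.map_apply]
      congr 1
      by_cases hkl : k = l
      · subst hkl; simp [coordAct]
      · simp [Matrix.diagonal_apply_ne _ hkl]
    change coordAct g (centralDefect n lam k l) ∈ Ideal.span _
    rw [key, Matrix.mul_apply]
    refine Ideal.sum_mem _ fun q _ => Ideal.mul_mem_right _ _ ?_
    rw [Matrix.mul_apply]
    refine Ideal.sum_mem _ fun p _ => Ideal.mul_mem_left _ _ (Ideal.subset_span ?_)
    exact Or.inl ⟨p, q, rfl⟩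
  · refine Ideal.subset_span (Or.inr ⟨i, ?_⟩)
    rw [externalDefect, Matrix.sub_apply, map_sub, coordAct_momentExternal]
    simp [coordAct]

/-- The induced action of `g ∈ GL_v` on `ℂ[μ⁻¹(λ)]`. -/
noncomputable def fibreAct {n : ℕ} (lam : Fin (n + 1) → ℂ) (g : GLv n) :
    FibreRing n lam →ₐ[ℂ] FibreRing n lam :=
  Ideal.quotientMapₐ (momentIdeal n lam) (coordAct g) (momentIdeal_le_comap lam g)

/-- The invariant ring `ℂ[Rep]^{SL_2}`. -/
noncomputable def invSL (n : ℕ) : Subalgebra ℂ (CoordRing n) :=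
  ⨅ h : Matrix.SpecialLinearGroup (Fin 2) ℂ,
    AlgHom.equalizer (coordAct (slIncl n h)) (AlgHom.id ℂ (CoordRing n))

/-- The invariant ring `ℂ[μ⁻¹(λ)]^{SL_2}`. -/
noncomputable def fibreInvSL (n : ℕ) (lam : Fin (n + 1) → ℂ) : Subalgebra ℂ (FibreRing n lam) :=
  ⨅ h : Matrix.SpecialLinearGroup (Fin 2) ℂ,
    AlgHom.equalizer (fibreAct lam (slIncl n h)) (AlgHom.id ℂ (FibreRing n lam))

/-- The invariant ring `ℂ[μ⁻¹(λ)]^{GL_v}`. -/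
noncomputable def fibreInvGL (n : ℕ) (lam : Fin (n + 1) → ℂ) : Subalgebra ℂ (FibreRing n lam) :=
  ⨅ g : GLv n, AlgHom.equalizer (fibreAct lam g) (AlgHom.id ℂ (FibreRing n lam))

theorem mem_invSL {n : ℕ} {f : CoordRing n} :
    f ∈ invSL n ↔ ∀ h, coordAct (slIncl n h) f = f := by
  simp [invSL, Algebra.mem_iInf, AlgHom.mem_equalizer]

theorem mem_fibreInvSL {n : ℕ} {lam : Fin (n + 1) → ℂ} {r : FibreRing n lam} :
    r ∈ fibreInvSL n lam ↔ ∀ h, fibreAct lam (slIncl n h) r = r := by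
  simp [fibreInvSL, Algebra.mem_iInf, AlgHom.mem_equalizer]

/-- The restriction of `SL_2`-invariant functions from the space of representations to the
fibre `μ⁻¹(λ)`. -/
noncomputable def restrictInv (n : ℕ) (lam : Fin (n + 1) → ℂ) :
    invSL n →ₐ[ℂ] fibreInvSL n lam :=
  ((Ideal.Quotient.mkₐ ℂ (momentIdeal n lam)).comp (invSL n).val).codRestrict (fibreInvSL n lam)
    (fun f => mem_fibreInvSL.2 fun h => by
      change Ideal.Quotient.mk _ (coordAct (slIncl n h) f.1) = Ideal.Quotient.mk _ f.1
      rw [mem_invSL.1 f.2 h])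

/-- The standard symplectic form on `V_0`. -/
def symp {R : Type} [CommRing R] (u w : Fin 2 → R) : R := u 0 * w 1 - u 1 * w 0

/-- The evaluation `ev_a` of the arrow `a`, as a vector in `V_0`. The row vector `B_{a_i}` in
`V_0^*` is identified with the vector `u` in `V_0` for which `B_{a_i} = symp u`. -/
def evVec {n : ℕ} {R : Type} [CommRing R] (V : QuiverRep n R) : Arrow n → Fin 2 → R
  | Sum.inl i => ![V.B i 0 1, -V.B i 0 0]
  | Sum.inr i => fun k => V.Bstar i k 0

theorem symp_evVec_inl {n : ℕ} {R : Type} [CommRing R] (V : QuiverRep n R) (i : Fin n)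
    (w : Fin 2 → R) : symp (evVec V (Sum.inl i)) w = (V.B i).mulVec w 0 := by
  simp [symp, evVec, Matrix.mulVec, dotProduct, Fin.sum_univ_two]
  ring

/-- The function `φ_{a,b} = ev_a ∧ ev_b`. -/
noncomputable def phi {n : ℕ} (a b : Arrow n) : CoordRing n :=
  symp (evVec (generic n) a) (evVec (generic n) b)

theorem coordAct_evVec {n : ℕ} (h : Matrix.SpecialLinearGroup (Fin 2) ℂ) (a : Arrow n)
    (k : Fin 2) : coordAct (slIncl n h) (evVec (generic n) a k) =
      ∑ l, MvPolynomial.C ((h⁻¹ : Matrix.SpecialLinearGroup (Fin 2) ℂ) k l) *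
        evVec (generic n) a l := by
  rcases a with i | i <;> fin_cases k <;>
    simp [evVec, coordAct, slIncl, generic, act, QuiverRep.coord, Matrix.mul_apply,
      Fin.sum_univ_two, Matrix.SpecialLinearGroup.coe_inv, Matrix.adjugate_fin_two,
      Matrix.inv_def] <;> ring

theorem phi_mem_invSL {n : ℕ} (a b : Arrow n) : phi a b ∈ invSL n := by
  refine mem_invSL.2 fun h => ?_
  have hdet := (h⁻¹ : Matrix.SpecialLinearGroup (Fin 2) ℂ).det_coe
  rw [Matrix.det_fin_two] at hdet
  have hC := congrArg (MvPolynomial.C (σ := Arrow n × Fin 2)) hdet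
  simp only [map_sub, map_mul, map_one] at hC
  simp only [phi, symp, map_sub, map_mul, coordAct_evVec, Fin.sum_univ_two]
  linear_combination (evVec (generic n) a 0 * evVec (generic n) b 1 -
    evVec (generic n) a 1 * evVec (generic n) b 0) * hC

/-- `φ_{a,b}` as an element of `ℂ[Rep]^{SL_2}`. -/
noncomputable def phiInv {n : ℕ} (a b : Arrow n) : invSL n := ⟨phi a b, phi_mem_invSL a b⟩

/-- The ideal of the skew-symmetry and Plücker relations, in the polynomial ring with one variable
for each ordered pair of arrows. -/
noncomputable def pluckerIdeal (n : ℕ) : Ideal (MvPolynomial (Arrow n × Arrow n) ℂ) :=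
  Ideal.span
    ({p | ∃ a b : Arrow n, p = MvPolynomial.X (a, b) + MvPolynomial.X (b, a)} ∪
     {p | ∃ a b c d : Arrow n, p =
        MvPolynomial.X (a, b) * MvPolynomial.X (c, d)
          - MvPolynomial.X (a, c) * MvPolynomial.X (b, d)
          + MvPolynomial.X (a, d) * MvPolynomial.X (b, c)})

/-- The ideal of `ℂ[Rep]^{SL_2}` generated by the equations of the fibre `μ⁻¹(λ)`. -/
noncomputable def invMomentIdeal (n : ℕ) (lam : Fin (n + 1) → ℂ) : Ideal (invSL n) :=
  Ideal.span
    ({f | ∃ i : Fin n, f = phiInv (Sum.inl i) (Sum.inr i) + algebraMap ℂ (invSL n) (lam i.succ)} ∪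
     {f | ∃ b c : Arrow n, f =
        ∑ i, phiInv (Sum.inl i) b * phiInv (Sum.inr i) c - lam 0 • phiInv b c})

/-- The monomial in the `φ_{a,b}` with exponents `m`. -/
noncomputable def phiMonomial {n : ℕ} (m : Arrow n × Arrow n →₀ ℕ) : CoordRing n :=
  m.prod fun p k => phi p.1 p.2 ^ k

/-- The number of occurrences of the arrow `a` as an index in the monomial with exponents `m`. -/
noncomputable def occurrences {n : ℕ} (m : Arrow n × Arrow n →₀ ℕ) (a : Arrow n) : ℕ :=
  m.sum fun p k => k * ((if p.1 = a then 1 else 0) + (if p.2 = a then 1 else 0))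

end Hyperpolygon

open Hyperpolygon

namespace Hyperpolygon

/-! Regard a representation as a family of vectors `u_a = ev_a` in `ℂ²`; then `φ_{a,b}` is the
bracket `[ab] = u_a ∧ u_b`. Of `SL_2` only the transvections are needed for the converse directions.
Their derivatives in the parameter are the operators `pol i j` with `i ≠ j`, so the argument runs
over `sl_2`.

The Casimir operator replaces averaging over the group. By Capelli's identity it acts on degree `d`
as `d(d+2) - 2 ∑ [ab] Ω_ab`, where the Cayley operators `Ω_ab` commute with it and lower the degree.
By induction, whatever it kills is a polynomial in the brackets
(`mem_bracketAlg_of_casimir_eq_zero`), and every function is sent to an invariant by some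
`q(casimir)` with `q(0) ≠ 0` (`hasReynolds`), which acts on invariants as the scalar `q(0)`. This
gives the generators in (i) and the surjectivity in (ii).

For the relations in (i), Plücker relations straighten every monomial into non-nested ones, whose
images have distinct leading monomials under a degeneration (`ker_bracketHom`).

For the kernel in (ii), the entries `M_kl` of the central equation are not invariant. A combination
`∑ g_kl M_kl` is the contraction of `P = ∑ g_kl y_k z_l`, in two auxiliary vectors `y`, `z`, with
the tensor `M`. Contraction commutes with the Casimir operator, so `P` may be replaced by a
polynomial in brackets. Its part bilinear in `y`, `z` is built from `[a y][b z]` and `[y z]`; the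
former contract to the quadratic relations, the latter to a trace which is a sum of the external
relations because `λ · v = 0` (`contract_mem`).

For (iii), monomials in the `φ_{a,b}` are eigenvectors of the torus, and independence of characters
leaves only the balanced ones. -/

open MvPolynomial

/-- The coordinate ring of the space of families of vectors `u_a ∈ ℂ^2` indexed by `A`. -/
abbrev VecRing (A : Type) : Type := MvPolynomial (A × Fin 2) ℂ

/-! ### Casimir operator, Capelli's identity and the first fundamental theorem -/

section Polarization

variable {A : Type}

/-- The bracket `u_a ∧ u_b`. -/
noncomputable def bracket (a b : A) : VecRing A :=
  symp (fun k => X (a, k)) (fun k => X (b, k))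

theorem bracket_eq (a b : A) :
    (bracket a b : VecRing A) = X (a, 0) * X (b, 1) - X (a, 1) * X (b, 0) := rfl

/-- The subalgebra generated by the brackets. -/
noncomputable def bracketAlg (A : Type) : Subalgebra ℂ (VecRing A) :=
  Algebra.adjoin ℂ (Set.range fun p : A × A => bracket p.1 p.2)

theorem bracket_mem (a b : A) : bracket a b ∈ bracketAlg A :=
  Algebra.subset_adjoin ⟨(a, b), rfl⟩

/-- The derivation by which the elementary matrix `e_{ij}` of `gl_2` acts on functions,
`∑ a, u_{a,i} ∂/∂u_{a,j}`. -/
noncomputable def pol (i j : Fin 2) : Derivation ℂ (VecRing A) (VecRing A) :=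
  mkDerivation ℂ fun p => if p.2 = j then X (p.1, i) else 0

@[simp] theorem pol_X (i j : Fin 2) (a : A) (k : Fin 2) :
    pol i j (X (a, k) : VecRing A) = if k = j then X (a, i) else 0 := by
  simp [pol]

/-- A commutator of derivations is a derivation, so comparison on the variables suffices. The same
reason gives the `gl_2` brackets in `pol_pol`. -/
theorem pderiv_pol [DecidableEq A] (i j k : Fin 2) (a : A) (f : VecRing A) :
    pderiv (a, k) (pol i j f) =
      pol i j (pderiv (a, k) f) + if i = k then pderiv (a, j) f else 0 := by
  have h : ⁅(pderiv (a, k) : Derivation ℂ (VecRing A) (VecRing A)),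
      (pol i j : Derivation ℂ (VecRing A) (VecRing A))⁆ =
      if i = k then pderiv (a, j) else 0 := by
    refine derivation_ext fun ⟨b, l⟩ => ?_
    rw [Derivation.commutator_apply, pol_X, pderiv_X]
    by_cases hl : l = j <;> by_cases hk : i = k <;> by_cases hb : b = a <;>
      simp [Pi.single_apply, hl, hk, hb, pderiv_X, apply_ite]
  have h' := DFunLike.congr_fun h f
  rw [Derivation.commutator_apply, sub_eq_iff_eq_add'] at h'
  rw [h']
  split_ifs <;> simp

theorem pol_pol (i j k l : Fin 2) (f : VecRing A) :
    pol i j (pol k l f) = pol k l (pol i j f) + (if j = k then pol i l f else 0) -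
      if i = l then pol k j f else 0 := by
  have h : ⁅(pol i j : Derivation ℂ (VecRing A) (VecRing A)),
      (pol k l : Derivation ℂ (VecRing A) (VecRing A))⁆ =
      (if j = k then pol i l else 0) - if i = l then pol k j else 0 := by
    refine derivation_ext fun ⟨b, m⟩ => ?_
    rw [Derivation.commutator_apply, pol_X, pol_X]
    rw [apply_ite (pol i j), apply_ite (pol k l), Derivation.sub_apply,
      apply_ite (fun D : Derivation ℂ (VecRing A) (VecRing A) => D (X (b, m))),
      apply_ite (fun D : Derivation ℂ (VecRing A) (VecRing A) => D (X (b, m)))]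
    simp only [pol_X, map_zero, Derivation.zero_apply]
    split_ifs <;> first | rfl | (subst_vars; first | rfl | contradiction)
  have h' := DFunLike.congr_fun h f
  rw [Derivation.commutator_apply, sub_eq_iff_eq_add'] at h'
  rw [h']
  split_ifs <;> simp <;> ring

theorem derivation_sum_apply {R S M ι : Type*} [CommSemiring R] [CommSemiring S] [AddCommMonoid M]
    [Algebra R S] [Module S M] [Module R M] (s : Finset ι) (D : ι → Derivation R S M) (f : S) :
    (∑ i ∈ s, D i) f = ∑ i ∈ s, D i f := by
  have := congrFun (map_sum (Derivation.coeFnAddMonoidHom : Derivation R S M →+ S → M) D s) f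
  rwa [Finset.sum_apply] at this

theorem pol_eq_sum [Fintype A] (i j : Fin 2) (f : VecRing A) :
    pol i j f = ∑ a, X (a, i) * pderiv (a, j) f := by
  classical
  have h : (pol i j : Derivation ℂ (VecRing A) (VecRing A)) =
      ∑ a, (X (a, i) : VecRing A) • pderiv (a, j) := by
    refine derivation_ext fun ⟨b, m⟩ => ?_
    rw [pol_X, derivation_sum_apply]
    by_cases hm : m = j <;> simp [pderiv_X, Pi.single_apply, hm, Prod.ext_iff]
  rw [h, derivation_sum_apply]
  simp

/-- The Cartan element of `sl_2`, acting on functions. -/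
noncomputable def cartan : Derivation ℂ (VecRing A) (VecRing A) := pol 0 0 - pol 1 1

theorem cartan_apply (f : VecRing A) : cartan f = pol 0 0 f - pol 1 1 f := rfl

/-- Four times the Casimir operator of `sl_2`. -/
noncomputable def casimir : Module.End ℂ (VecRing A) :=
  (4 : ℂ) • ((pol 0 1).toLinearMap * (pol 1 0).toLinearMap) +
    cartan.toLinearMap * cartan.toLinearMap - (2 : ℂ) • cartan.toLinearMap

theorem casimir_apply (f : VecRing A) :
    casimir f = 4 * pol 0 1 (pol 1 0 f) + cartan (cartan f) - 2 * cartan f := by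
  simp [casimir, Algebra.smul_def]
  rfl

theorem pol_bracket (a b : A) :
    pol 0 1 (bracket a b) = 0 ∧ pol 1 0 (bracket a b) = 0 ∧ cartan (bracket a b) = 0 := by
  simp [bracket_eq, cartan_apply]
  ring_nf
  simp

/-- Each derivation in the Casimir operator treats `p` as a scalar, so the operator is linear over
the invariants. -/
theorem casimir_mul_of_eq_zero {p : VecRing A} (h : pol 0 1 p = 0 ∧ pol 1 0 p = 0 ∧ cartan p = 0)
    (f : VecRing A) : casimir (p * f) = p * casimir f := by
  obtain ⟨h1, h2, h3⟩ := h
  have h (D : Derivation ℂ (VecRing A) (VecRing A)) (hD : D p = 0) (g : VecRing A) :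
      D (p * g) = p * D g := by simp [hD]
  simp only [casimir_apply, h _ h1, h _ h2, h _ h3]
  ring

theorem casimir_bracket_mul (a b : A) (f : VecRing A) :
    casimir (bracket a b * f) = bracket a b * casimir f :=
  casimir_mul_of_eq_zero (pol_bracket a b) f

/-- Cayley's operator `∂_{a,0} ∂_{b,1} - ∂_{a,1} ∂_{b,0}`. -/
noncomputable def cayley (a b : A) : Module.End ℂ (VecRing A) :=
  (pderiv (a, 0)).toLinearMap * (pderiv (b, 1)).toLinearMap -
    (pderiv (a, 1)).toLinearMap * (pderiv (b, 0)).toLinearMap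

theorem cayley_apply (a b : A) (f : VecRing A) : cayley a b f =
    pderiv (a, 0) (pderiv (b, 1) f) - pderiv (a, 1) (pderiv (b, 0) f) := rfl

/-- The shifts from `pderiv_pol` cancel by antisymmetry for `pol 0 1` and `pol 1 0`. Each of `pol 0
0` and `pol 1 1` shifts by `Ω`, so of these only the difference commutes. -/
theorem cayley_pol (a b : A) (f : VecRing A) :
    cayley a b (pol 0 1 f) = pol 0 1 (cayley a b f) ∧
    cayley a b (pol 1 0 f) = pol 1 0 (cayley a b f) ∧
    cayley a b (cartan f) = cartan (cayley a b f) := by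
  classical
  simp only [cayley_apply, cartan_apply, pderiv_pol, map_sub, map_add]
  simp
  ring

theorem cayley_casimir (a b : A) (f : VecRing A) :
    cayley a b (casimir f) = casimir (cayley a b f) := by
  have h (f : VecRing A) : casimir f = (4 : ℂ) • pol 0 1 (pol 1 0 f) + cartan (cartan f) -
      (2 : ℂ) • cartan f := rfl
  simp only [h, map_sub, map_add, map_smul, cayley_pol]

theorem isHomogeneous_pol [Fintype A] (i j : Fin 2) {f : VecRing A} {d : ℕ}
    (hf : f.IsHomogeneous d) : (pol i j f).IsHomogeneous d := by
  rcases d with _ | d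
  · obtain ⟨c, rfl⟩ : ∃ c, f = C c :=
      ⟨_, totalDegree_eq_zero_iff_eq_C.1 ((totalDegree_zero_iff_isHomogeneous _).2 hf)⟩
    rw [derivation_C]
    exact isHomogeneous_zero _ _ _
  · rw [pol_eq_sum]
    refine IsHomogeneous.sum _ _ _ fun a _ => ?_
    rw [add_comm]
    exact (isHomogeneous_X _ _).mul hf.pderiv

theorem isHomogeneous_casimir [Fintype A] {f : VecRing A} {d : ℕ}
    (hf : f.IsHomogeneous d) : (casimir f).IsHomogeneous d := by
  have h (f : VecRing A) : casimir f = C 4 * pol 0 1 (pol 1 0 f) + cartan (cartan f) -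
      C 2 * cartan f := casimir_apply f
  have hc {g : VecRing A} (hg : g.IsHomogeneous d) : (cartan g).IsHomogeneous d :=
    (isHomogeneous_pol _ _ hg).sub (isHomogeneous_pol _ _ hg)
  rw [h]
  exact (((isHomogeneous_pol _ _ (isHomogeneous_pol _ _ hf)).C_mul _).add (hc (hc hf))).sub
    ((hc hf).C_mul _)

/-- Normal ordering: the outer derivative also hits the coefficient `X (b, k)`. The resulting
first-order term is the source of the correction in Capelli's identity. -/
theorem pol_pol_eq_sum [Fintype A] (i j k l : Fin 2) (f : VecRing A) :
    pol i j (pol k l f) = (∑ a, ∑ b, (X (a, i) * X (b, k) : VecRing A) *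
      pderiv (a, j) (pderiv (b, l) f)) + if k = j then pol i l f else 0 := by
  have h (b : A) : pol i j (X (b, k) * pderiv (b, l) f) =
      (∑ a, (X (a, i) * X (b, k) : VecRing A) * pderiv (a, j) (pderiv (b, l) f)) +
        if k = j then X (b, i) * pderiv (b, l) f else 0 := by
    rw [Derivation.leibniz, pol_X, pol_eq_sum i j (pderiv (b, l) f), smul_eq_mul, Finset.mul_sum]
    refine congrArg₂ _ (Finset.sum_congr rfl fun a _ => ?_) ?_
    · rw [mul_left_comm, mul_assoc]
    · split_ifs
      · rw [smul_eq_mul, mul_comm]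
      · rw [smul_zero]
  rw [pol_eq_sum k l, map_sum, Finset.sum_congr rfl fun b _ => h b, Finset.sum_add_distrib,
    Finset.sum_comm]
  refine congrArg₂ _ rfl ?_
  split_ifs
  · rw [pol_eq_sum]
  · rw [Finset.sum_const_zero]

/-- Capelli's identity. -/
theorem sum_bracket_mul_cayley [Fintype A] (f : VecRing A) :
    ∑ a, ∑ b, bracket a b * cayley a b f =
      2 * (pol 0 0 (pol 1 1 f) - pol 0 1 (pol 1 0 f) + pol 0 0 f) := by
  have e (a b : A) : bracket a b * cayley a b f =
      X (a, 0) * X (b, 1) * pderiv (a, 0) (pderiv (b, 1) f) +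
      X (a, 1) * X (b, 0) * pderiv (a, 1) (pderiv (b, 0) f) -
      X (a, 0) * X (b, 1) * pderiv (a, 1) (pderiv (b, 0) f) -
      X (a, 1) * X (b, 0) * pderiv (a, 0) (pderiv (b, 1) f) := by
    rw [bracket_eq, cayley_apply]
    generalize pderiv (a, 0) (pderiv (b, 1) f) = p
    generalize pderiv (a, 1) (pderiv (b, 0) f) = q
    ring
  simp only [e, Finset.sum_add_distrib, Finset.sum_sub_distrib]
  have h1 := pol_pol_eq_sum 0 0 1 1 f
  have h2 := pol_pol_eq_sum 1 1 0 0 f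
  have h3 := pol_pol_eq_sum 0 1 1 0 f
  have h4 := pol_pol_eq_sum 1 0 0 1 f
  rw [pol_pol 1 1 0 0] at h2
  rw [pol_pol 1 0 0 1] at h4
  simp only [Fin.isValue, one_ne_zero, zero_ne_one, if_true, if_false, add_zero, sub_zero]
    at h1 h2 h3 h4
  rw [← h1, ← h2, eq_sub_of_add_eq h3.symm, eq_sub_of_add_eq h4.symm]
  ring

/-- Euler's formula makes `pol 0 0 + pol 1 1` the scalar `d`; eliminating it, the Casimir and
Capelli operators differ by a scalar. -/
theorem casimir_of_isHomogeneous [Fintype A] {f : VecRing A} {d : ℕ} (hf : f.IsHomogeneous d) :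
    casimir f = ((d * (d + 2) : ℕ) : VecRing A) * f -
      2 * ∑ a, ∑ b, bracket a b * cayley a b f := by
  have euler {g : VecRing A} (hg : g.IsHomogeneous d) : pol 0 0 g + pol 1 1 g = d * g := by
    have := hg.sum_X_mul_pderiv
    rw [Fintype.sum_prod_type, nsmul_eq_mul] at this
    simp only [Fin.sum_univ_two, Finset.sum_add_distrib] at this
    rw [pol_eq_sum, pol_eq_sum, this]
  rw [sum_bracket_mul_cayley, casimir_apply]
  simp only [cartan_apply, map_sub]
  have h0 := euler hf
  have h1 := euler (isHomogeneous_pol 0 0 hf)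
  have h2 := euler (isHomogeneous_pol 1 1 hf)
  rw [pol_pol 1 1 0 0] at h1 ⊢
  simp at h1
  simp
  linear_combination (d + 2) * h0 + h1 + h2

/-- The first fundamental theorem for `sl_2`: a function killed by the Casimir operator is a
polynomial in the brackets. -/
theorem mem_bracketAlg_of_casimir_eq_zero [Fintype A] {f : VecRing A} (hf : casimir f = 0) :
    f ∈ bracketAlg A := by
  have hom (d : ℕ) : ∀ f : VecRing A, f.IsHomogeneous d → casimir f = 0 → f ∈ bracketAlg A := by
    induction d using Nat.strong_induction_on with
    | _ d ih =>
      intro f hf h0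
      rcases Nat.eq_zero_or_pos d with rfl | hd
      · rw [totalDegree_eq_zero_iff_eq_C.1 ((totalDegree_zero_iff_isHomogeneous _).2 hf)]
        exact (bracketAlg A).algebraMap_mem _
      · have key := casimir_of_isHomogeneous hf
        rw [h0, eq_comm, sub_eq_zero] at key
        have hs : ∑ a, ∑ b, bracket a b * cayley a b f ∈ bracketAlg A := by
          refine sum_mem fun a _ => sum_mem fun b _ => mul_mem (bracket_mem a b) ?_
          -- The subtraction is truncated: for `d = 1` the degree is `0`, still below `d`.
          refine ih (d - 1 - 1) (by omega) _ (hf.pderiv.pderiv.sub hf.pderiv.pderiv) ?_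
          rw [← cayley_casimir, h0, map_zero]
        have hc : ((d * (d + 2) : ℕ) : ℂ) ≠ 0 :=
          Nat.cast_ne_zero.2 (by positivity)
        have : f = ((d * (d + 2) : ℕ) : ℂ)⁻¹ • (2 : ℂ) •
            ∑ a, ∑ b, bracket a b * cayley a b f := by
          rw [eq_inv_smul_iff₀ hc, Algebra.smul_def, Algebra.smul_def, map_natCast]
          exact key
        rw [this]
        exact Subalgebra.smul_mem _ (Subalgebra.smul_mem _ hs _) _
  rw [← sum_homogeneousComponent f]
  refine sum_mem fun d hd => hom d _ (homogeneousComponent_isHomogeneous _ _) ?_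
  have h : casimir (homogeneousComponent d f) = homogeneousComponent d (casimir f) := by
    conv_rhs => rw [← sum_homogeneousComponent f]
    rw [map_sum, map_sum]
    have (i : ℕ) : homogeneousComponent d (casimir (homogeneousComponent i f)) =
        if d = i then casimir (homogeneousComponent i f) else 0 := by
      rw [homogeneousComponent_of_mem
        (isHomogeneous_casimir (homogeneousComponent_isHomogeneous i f))]
    rw [Finset.sum_congr rfl fun i _ => this i, Finset.sum_ite_eq, if_pos hd]
  rw [h, hf, map_zero]

theorem casimir_of_mem_bracketAlg {f : VecRing A} (hf : f ∈ bracketAlg A) :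
    pol 0 1 f = 0 ∧ pol 1 0 f = 0 ∧ cartan f = 0 := by
  induction hf using Algebra.adjoin_induction with
  | mem x hx => obtain ⟨p, rfl⟩ := hx; exact pol_bracket _ _
  | algebraMap r => simp
  | add x y _ _ hx hy => simp [hx, hy]
  | mul x y _ _ hx hy => simp [hx, hy]

theorem casimir_mul_of_mem {p : VecRing A} (hp : p ∈ bracketAlg A) (f : VecRing A) :
    casimir (p * f) = p * casimir f :=
  casimir_mul_of_eq_zero (casimir_of_mem_bracketAlg hp) f

theorem aeval_casimir_mul_of_mem {p : VecRing A} (hp : p ∈ bracketAlg A) (f : VecRing A)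
    (q : Polynomial ℂ) :
    Polynomial.aeval casimir q (p * f) = p * Polynomial.aeval casimir q f := by
  induction q using Polynomial.induction_on' with
  | add q r hq hr => simp [hq, hr, mul_add]
  | monomial n c =>
    have : ∀ n f, ((casimir : Module.End ℂ (VecRing A)) ^ n) (p * f) =
        p * ((casimir : Module.End ℂ (VecRing A)) ^ n) f := by
      intro n
      induction n with
      | zero => simp
      | succ n ih => intro f; simp [pow_succ, casimir_mul_of_mem hp, ih]
    simp [Polynomial.aeval_monomial, this]

/-- The polynomials `q` in the Casimir operator with `q(0) ≠ 0` replace the Reynolds operator. -/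
def HasReynolds (f : VecRing A) : Prop :=
  ∃ q : Polynomial ℂ, q.coeff 0 ≠ 0 ∧ casimir (Polynomial.aeval casimir q f) = 0

theorem casimir_aeval_mul (q r : Polynomial ℂ) {f : VecRing A}
    (hf : casimir (Polynomial.aeval casimir q f) = 0) :
    casimir (Polynomial.aeval casimir (q * r) f) = 0 := by
  have h (q : Polynomial ℂ) (f : VecRing A) : casimir (Polynomial.aeval casimir q f) =
      Polynomial.aeval casimir (Polynomial.X * q) f := by simp
  rw [h, ← mul_assoc, mul_comm, map_mul, Module.End.mul_apply, ← h, hf, map_zero]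

/-- A product of admissible polynomials is admissible for all the functions at once, and its
constant term stays nonzero. -/
theorem exists_common_reynolds {ι : Type*} (s : Finset ι) (f : ι → VecRing A)
    (hf : ∀ i ∈ s, HasReynolds (f i)) : ∃ q : Polynomial ℂ, q.coeff 0 ≠ 0 ∧
      ∀ i ∈ s, casimir (Polynomial.aeval casimir q (f i)) = 0 := by
  classical
  induction s using Finset.induction_on with
  | empty => exact ⟨1, by simp, by simp⟩
  | insert a s ha ih =>
    obtain ⟨q, hq0, hq⟩ := ih fun i hi => hf i (Finset.mem_insert_of_mem hi)
    obtain ⟨r, hr0, hr⟩ := hf a (Finset.mem_insert_self _ _)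
    refine ⟨q * r, by simp [Polynomial.mul_coeff_zero, hq0, hr0], fun i hi => ?_⟩
    rcases Finset.mem_insert.1 hi with rfl | hi
    · rw [mul_comm]; exact casimir_aeval_mul _ _ hr
    · exact casimir_aeval_mul _ _ (hq i hi)

theorem HasReynolds.sum {ι : Type*} (s : Finset ι) (f : ι → VecRing A)
    (hf : ∀ i ∈ s, HasReynolds (f i)) : HasReynolds (∑ i ∈ s, f i) := by
  obtain ⟨q, h0, hq⟩ := exists_common_reynolds s f hf
  refine ⟨q, h0, ?_⟩
  rw [map_sum, map_sum]
  exact Finset.sum_eq_zero hq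

/-- In degree `d`, `casimir - d(d+2)` sends `f` to a combination of the `[ab] Ω_ab f`. Brackets pass
through the Casimir operator and `Ω_ab f` has lower degree, so a polynomial for the sum times `X -
d(d+2)` works for `f`; its constant term is nonzero as `d > 0`. -/
theorem hasReynolds [Fintype A] (f : VecRing A) : HasReynolds f := by
  have hom (d : ℕ) : ∀ f : VecRing A, f.IsHomogeneous d → HasReynolds f := by
    induction d using Nat.strong_induction_on with
    | _ d ih =>
      intro f hf
      rcases Nat.eq_zero_or_pos d with rfl | hd
      · rw [totalDegree_eq_zero_iff_eq_C.1 ((totalDegree_zero_iff_isHomogeneous _).2 hf)]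
        exact ⟨1, by simp, by simp [casimir_apply]⟩
      · have hs : HasReynolds (∑ a, ∑ b, bracket a b * cayley a b f) := by
          refine HasReynolds.sum _ _ fun a _ => HasReynolds.sum _ _ fun b _ => ?_
          obtain ⟨q, h0, hq⟩ := ih (d - 1 - 1) (by omega) (cayley a b f)
            (hf.pderiv.pderiv.sub hf.pderiv.pderiv)
          refine ⟨q, h0, ?_⟩
          rw [aeval_casimir_mul_of_mem (bracket_mem a b), casimir_bracket_mul, hq, mul_zero]
        obtain ⟨q, h0, hq⟩ := hs
        have hc : ((d * (d + 2) : ℕ) : ℂ) ≠ 0 :=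
          Nat.cast_ne_zero.2 (by positivity)
        refine ⟨q * (Polynomial.X - Polynomial.C ((d * (d + 2) : ℕ) : ℂ)), ?_, ?_⟩
        · simpa [Polynomial.mul_coeff_zero, h0] using hc
        · have : Polynomial.aeval casimir (Polynomial.X - Polynomial.C ((d * (d + 2) : ℕ) : ℂ)) f =
              (-2 : ℂ) • ∑ a, ∑ b, bracket a b * cayley a b f := by
            rw [map_sub, Polynomial.aeval_X, Polynomial.aeval_C, LinearMap.sub_apply,
              casimir_of_isHomogeneous hf, Module.algebraMap_end_apply, Algebra.smul_def,
              Algebra.smul_def, map_natCast, map_neg, map_ofNat]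
            ring
          rw [map_mul, Module.End.mul_apply, this, map_smul, map_smul, hq, smul_zero]
  rw [← sum_homogeneousComponent f]
  exact HasReynolds.sum _ _ fun d _ => hom d _ (homogeneousComponent_isHomogeneous _ _)

end Polarization

/-! ### Standard monomials and the second fundamental theorem -/

section Straightening

variable {A : Type}

/-- The ideal of skew-symmetry and Plücker relations between the brackets of vectors `u_a`. -/
noncomputable def relIdeal (A : Type) : Ideal (MvPolynomial (A × A) ℂ) :=
  Ideal.span
    ({p | ∃ a b : A, p = X (a, b) + X (b, a)} ∪
     {p | ∃ a b c d : A, p = X (a, b) * X (c, d) - X (a, c) * X (b, d) + X (a, d) * X (b, c)})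

/-- The homomorphism from the polynomial ring to functions which evaluates variables at brackets. -/
noncomputable def bracketHom (A : Type) : MvPolynomial (A × A) ℂ →ₐ[ℂ] VecRing A :=
  aeval fun p : A × A => bracket p.1 p.2

theorem relIdeal_le_ker : relIdeal A ≤ RingHom.ker (bracketHom A) := by
  rw [relIdeal, Ideal.span_le]
  rintro f (⟨a, b, rfl⟩ | ⟨a, b, c, d, rfl⟩) <;>
    simp [RingHom.mem_ker, bracketHom, bracket_eq] <;> ring

/-- The monomial in the variables `X (a, b)` given by a multiset of pairs. -/
noncomputable def pairMonomial (s : Multiset (A × A)) : MvPolynomial (A × A) ℂ :=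
  (s.map X).prod

theorem pairMonomial_cons (p : A × A) (s : Multiset (A × A)) :
    pairMonomial (p ::ₘ s) = X p * pairMonomial s := by
  simp [pairMonomial]

variable [LinearOrder A]

/-- A multiset of pairs is oriented if the entries of each pair are increasing. -/
def IsOriented (s : Multiset (A × A)) : Prop := ∀ p ∈ s, p.1 < p.2

/-- A multiset of pairs is standard if it is oriented and no pair is nested in another one. -/
def IsStandard (s : Multiset (A × A)) : Prop :=
  IsOriented s ∧ ∀ p ∈ s, ∀ q ∈ s, ¬(p.1 < q.1 ∧ q.2 < p.2)

/-- The span of the standard monomials and the relations. -/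
noncomputable def straightSpan (A : Type) [LinearOrder A] :
    Submodule ℂ (MvPolynomial (A × A) ℂ) :=
  Submodule.span ℂ (Set.range fun s : {s : Multiset (A × A) // IsStandard s} =>
    pairMonomial s.1) ⊔ (relIdeal A).restrictScalars ℂ

/-- For nested pairs `a < c < d < b`, rewrite `[ab][cd] = [ad][cb] - [ac][db]`. If `p, q, r > 0` are
the successive gaps between the weights of `a, c, d, b`, the sum of squared lengths drops by at
least `2pr` in both terms, so the process stops. -/
theorem pairMonomial_mem_of_isOriented (w : A → ℕ) (hw : StrictMono w) (s : Multiset (A × A))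
    (hs : IsOriented s) : pairMonomial s ∈ straightSpan A := by
  induction hN : (s.map fun p => (w p.2 - w p.1) ^ 2).sum using Nat.strong_induction_on
    generalizing s with
  | _ N ih =>
    by_cases hst : IsStandard s
    · exact Submodule.mem_sup_left (Submodule.subset_span ⟨⟨s, hst⟩, rfl⟩)
    · simp only [IsStandard, not_and, not_forall, not_not] at hst
      obtain ⟨⟨a, b⟩, hp, ⟨c, d⟩, hq, hac, hdb⟩ := hst hs
      obtain ⟨t, rfl⟩ := Multiset.exists_cons_of_mem hp
      have hq' : (c, d) ∈ t := (Multiset.mem_cons.1 hq).resolve_left fun h => by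
        simp only [Prod.mk.injEq] at h
        exact hac.ne h.1.symm
      obtain ⟨t, rfl⟩ := Multiset.exists_cons_of_mem hq'
      have hcd : c < d := hs (c, d) hq
      simp only at hac hdb
      have ht : IsOriented t := fun p hp => hs p (by simp [hp])
      have ho {a b c d : A} (hab : a < b) (hcd : c < d) : IsOriented ((a, b) ::ₘ (c, d) ::ₘ t) := by
        intro p hp
        simp only [Multiset.mem_cons] at hp
        rcases hp with rfl | rfl | hp
        · exact hab
        · exact hcd
        · exact ht p hp
      simp only [Multiset.map_cons, Multiset.sum_cons] at hN
      obtain ⟨x, hx⟩ := Nat.exists_eq_add_of_lt (hw hac)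
      obtain ⟨y, hy⟩ := Nat.exists_eq_add_of_lt (hw hcd)
      obtain ⟨z, hz⟩ := Nat.exists_eq_add_of_lt (hw hdb)
      have e1 : w b - w a = x + y + z + 3 := by omega
      have e2 : w d - w c = y + 1 := by omega
      have e3 : w c - w a = x + 1 := by omega
      have e4 : w b - w d = z + 1 := by omega
      have e5 : w d - w a = x + y + 2 := by omega
      have e6 : w b - w c = y + z + 2 := by omega
      rw [e1, e2] at hN
      have h1 := ih _ (by
        rw [← hN]
        simp only [Multiset.map_cons, Multiset.sum_cons, e3, e4]
        nlinarith) ((a, c) ::ₘ (d, b) ::ₘ t) (ho hac hdb) rfl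
      have h2 := ih _ (by
        rw [← hN]
        simp only [Multiset.map_cons, Multiset.sum_cons, e5, e6]
        nlinarith) ((a, d) ::ₘ (c, b) ::ₘ t) (ho (hac.trans hcd) (hcd.trans hdb)) rfl
      have r1 : (X (a, b) * X (c, d) - X (a, c) * X (b, d) + X (a, d) * X (b, c) :
          MvPolynomial (A × A) ℂ) ∈ relIdeal A :=
        Ideal.subset_span (Or.inr ⟨a, b, c, d, rfl⟩)
      have r2 (i j : A) : (X (i, j) + X (j, i) : MvPolynomial (A × A) ℂ) ∈ relIdeal A :=
        Ideal.subset_span (Or.inl ⟨i, j, rfl⟩)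
      have h3 : pairMonomial ((a, b) ::ₘ (c, d) ::ₘ t) - (pairMonomial ((a, d) ::ₘ (c, b) ::ₘ t) -
          pairMonomial ((a, c) ::ₘ (d, b) ::ₘ t)) ∈ relIdeal A := by
        have : pairMonomial ((a, b) ::ₘ (c, d) ::ₘ t) - (pairMonomial ((a, d) ::ₘ (c, b) ::ₘ t) -
          pairMonomial ((a, c) ::ₘ (d, b) ::ₘ t)) =
          pairMonomial t * (X (a, b) * X (c, d) - X (a, c) * X (b, d) + X (a, d) * X (b, c)) +
          pairMonomial t * X (a, c) * (X (b, d) + X (d, b)) -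
          pairMonomial t * X (a, d) * (X (b, c) + X (c, b)) := by
          simp only [pairMonomial_cons]
          ring
        rw [this]
        exact sub_mem (add_mem (Ideal.mul_mem_left _ _ r1) (Ideal.mul_mem_left _ _ (r2 _ _)))
          (Ideal.mul_mem_left _ _ (r2 _ _))
      rw [← sub_add_cancel (pairMonomial ((a, b) ::ₘ (c, d) ::ₘ t))
        (pairMonomial ((a, d) ::ₘ (c, b) ::ₘ t) - pairMonomial ((a, c) ::ₘ (d, b) ::ₘ t))]
      exact add_mem (Submodule.mem_sup_right h3) (sub_mem h2 h1)

theorem exists_oriented (s : Multiset (A × A)) : ∃ (c : ℂ) (t : Multiset (A × A)),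
    IsOriented t ∧ pairMonomial s - C c * pairMonomial t ∈ relIdeal A := by
  induction s using Multiset.induction_on with
  | empty => exact ⟨1, 0, by simp [IsOriented], by simp⟩
  | cons p s ih =>
    obtain ⟨c, t, ht, h⟩ := ih
    have r (i j : A) : (X (i, j) + X (j, i) : MvPolynomial (A × A) ℂ) ∈ relIdeal A :=
      Ideal.subset_span (Or.inl ⟨i, j, rfl⟩)
    have ho (q : A × A) (hq : q.1 < q.2) : IsOriented (q ::ₘ t) := by
      intro p hp
      rcases Multiset.mem_cons.1 hp with rfl | hp
      exacts [hq, ht p hp]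
    obtain ⟨a, b⟩ := p
    rcases lt_trichotomy a b with hab | rfl | hab
    · refine ⟨c, (a, b) ::ₘ t, ho _ hab, ?_⟩
      rw [pairMonomial_cons, pairMonomial_cons, mul_left_comm, ← mul_sub]
      exact Ideal.mul_mem_left _ _ h
    -- Half of the skew-symmetry relation for `(a, a)` is `X (a, a)`, so the monomial vanishes
    -- modulo the relations.
    · refine ⟨0, 0, by simp [IsOriented], ?_⟩
      have : pairMonomial ((a, a) ::ₘ s) - C 0 * pairMonomial 0 =
          C (1 / 2) * pairMonomial s * (X (a, a) + X (a, a)) := by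
        have h2 : (C (1 / 2) * 2 : MvPolynomial (A × A) ℂ) = 1 := by
          rw [← map_ofNat (C (σ := A × A) (R := ℂ)) 2, ← C_mul]
          norm_num
        rw [pairMonomial_cons, C_0]
        linear_combination (-(X (a, a) * pairMonomial s)) * h2
      rw [this]
      exact Ideal.mul_mem_left _ _ (r a a)
    · refine ⟨-c, (b, a) ::ₘ t, ho _ hab, ?_⟩
      have : pairMonomial ((a, b) ::ₘ s) - C (-c) * pairMonomial ((b, a) ::ₘ t) =
          X (a, b) * (pairMonomial s - C c * pairMonomial t) +
          C c * pairMonomial t * (X (a, b) + X (b, a)) := by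
        rw [pairMonomial_cons, pairMonomial_cons, C_neg]
        ring
      rw [this]
      exact add_mem (Ideal.mul_mem_left _ _ h) (Ideal.mul_mem_left _ _ (r a b))

theorem straightSpan_eq_top (w : A → ℕ) (hw : StrictMono w) : straightSpan A = ⊤ := by
  have h1 (s : Multiset (A × A)) : pairMonomial s ∈ straightSpan A := by
    obtain ⟨c, t, ht, h⟩ := exists_oriented s
    rw [← sub_add_cancel (pairMonomial s) (C c * pairMonomial t), ← smul_eq_C_mul]
    rw [← smul_eq_C_mul] at h
    exact add_mem (Submodule.mem_sup_right h)
      (Submodule.smul_mem _ _ (pairMonomial_mem_of_isOriented w hw t ht))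
  rw [eq_top_iff]
  rintro f -
  have h2 : f ∈ Submodule.span ℂ (Set.range (pairMonomial (A := A))) := by
    induction f using MvPolynomial.induction_on with
    | C a =>
      rw [← mul_one (C a), ← smul_eq_C_mul]
      exact Submodule.smul_mem _ _ (Submodule.subset_span ⟨0, by simp [pairMonomial]⟩)
    | add p q hp hq => exact add_mem hp hq
    | mul_X p i hp =>
      induction hp using Submodule.span_induction with
      | mem x hx =>
        obtain ⟨s, rfl⟩ := hx
        exact Submodule.subset_span ⟨i ::ₘ s, by rw [pairMonomial_cons, mul_comm]⟩
      | zero => simp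
      | add x y _ _ hx hy => rw [add_mul]; exact add_mem hx hy
      | smul a x _ hx => rw [smul_mul_assoc]; exact Submodule.smul_mem _ _ hx
  refine Submodule.span_le.2 ?_ h2
  rintro _ ⟨s, rfl⟩
  exact h1 s

/-- A standard multiset of pairs is determined by its first and its second entries. -/
theorem IsStandard.eq_of_map_eq {s t : Multiset (A × A)} (hs : IsStandard s) (ht : IsStandard t)
    (h1 : s.map Prod.fst = t.map Prod.fst) (h2 : s.map Prod.snd = t.map Prod.snd) : s = t := by
  have key (s : Multiset (A × A)) (hs : IsStandard s) : ∃ l : List (A × A), (l : Multiset _) = s ∧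
      (l.map Prod.fst).Pairwise (· ≤ ·) ∧ (l.map Prod.snd).Pairwise (· ≤ ·) := by
    -- In lexicographic order the first entries increase weakly, and the absence of nesting makes
    -- the second entries do so too. Both lists are then determined by their multisets.
    let l := (s.map toLex).sort (· ≤ ·)
    have hl : ((l.map ofLex : List (A × A)) : Multiset (A × A)) = s := by
      rw [← Multiset.map_coe, Multiset.sort_eq, Multiset.map_map]
      exact Multiset.map_id s
    have hmem : ∀ x ∈ l, ofLex x ∈ s := by
      intro x hx
      rw [← hl]
      exact Multiset.mem_coe.2 (List.mem_map_of_mem hx)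
    have hsort : l.Pairwise (· ≤ ·) := Multiset.pairwise_sort _ _
    refine ⟨l.map ofLex, hl, ?_, ?_⟩
    · rw [List.map_map, List.pairwise_map]
      refine hsort.imp fun {x y} hxy => ?_
      rcases Prod.Lex.le_iff.1 hxy with h | h
      exacts [h.le, h.1.le]
    · rw [List.map_map, List.pairwise_map]
      refine hsort.imp_of_mem fun {x y} hx hy hxy => ?_
      rcases Prod.Lex.le_iff.1 hxy with h | h
      · exact not_lt.1 fun h' => hs.2 _ (hmem x hx) _ (hmem y hy) ⟨h, h'⟩
      · exact h.2
  obtain ⟨l, rfl, hl1, hl2⟩ := key s hs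
  obtain ⟨m, rfl, hm1, hm2⟩ := key t ht
  have e1 : l.map Prod.fst = m.map Prod.fst :=
    List.Perm.eq_of_pairwise' hl1 hm1 (Multiset.coe_eq_coe.1 h1)
  have e2 : l.map Prod.snd = m.map Prod.snd :=
    List.Perm.eq_of_pairwise' hl2 hm2 (Multiset.coe_eq_coe.1 h2)
  have hz (l : List (A × A)) : l = (l.map Prod.fst).zip (l.map Prod.snd) := by
    induction l with
    | nil => rfl
    | cons a l ih => rw [List.map_cons, List.map_cons, List.zip_cons_cons, ← ih]
  rw [hz l, hz m, e1, e2]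

/-- The family of vectors with second coordinates rescaled by powers of a parameter. -/
noncomputable def degeneration (w : A → ℕ) : VecRing A →ₐ[ℂ] Polynomial (VecRing A) :=
  aeval fun p => Polynomial.C (X p) * Polynomial.X ^ ((p.2 : ℕ) * w p.1)

/-- The two terms of the bracket have degrees `w b` and `w a` in the parameter, and `w a < w b`, so
the diagonal term leads. -/
theorem degeneration_bracket (w : A → ℕ) (hw : StrictMono w) {a b : A} (hab : a < b) :
    (degeneration w (bracket a b)).leadingCoeff = X (a, 0) * X (b, 1) ∧
    (degeneration w (bracket a b)).natDegree = w b := by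
  have e : degeneration w (bracket a b) =
      Polynomial.C (X (a, 0) * X (b, 1)) * Polynomial.X ^ w b -
      Polynomial.C (X (a, 1) * X (b, 0)) * Polynomial.X ^ w a := by
    simp [degeneration, bracket_eq]
    ring
  have h0 (i j : A × Fin 2) : (X i * X j : VecRing A) ≠ 0 := mul_ne_zero (X_ne_zero i) (X_ne_zero j)
  have hlt : (Polynomial.C (X (a, 1) * X (b, 0) : VecRing A) * Polynomial.X ^ w a).degree <
      (Polynomial.C (X (a, 0) * X (b, 1) : VecRing A) * Polynomial.X ^ w b).degree := by
    rw [Polynomial.degree_C_mul_X_pow _ (h0 _ _), Polynomial.degree_C_mul_X_pow _ (h0 _ _)]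
    exact_mod_cast hw hab
  rw [e]
  constructor
  · rw [Polynomial.leadingCoeff_sub_of_degree_lt hlt, Polynomial.leadingCoeff_C_mul_X_pow]
  · rw [Polynomial.natDegree_eq_of_degree_eq (Polynomial.degree_sub_eq_left_of_degree_lt hlt),
      Polynomial.natDegree_C_mul_X_pow _ _ (h0 _ _)]

/-- The exponents of the leading monomial of a product of oriented brackets. -/
noncomputable def leadExp (s : Multiset (A × A)) : A × Fin 2 →₀ ℕ :=
  Multiset.toFinsupp (s.map fun p => (p.1, (0 : Fin 2))) +
    Multiset.toFinsupp (s.map fun p => (p.2, (1 : Fin 2)))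

theorem degeneration_leadingCoeff (w : A → ℕ) (hw : StrictMono w) {s : Multiset (A × A)}
    (hs : IsOriented s) :
    (degeneration w (bracketHom A (pairMonomial s))).leadingCoeff = monomial (leadExp s) 1 := by
  induction s using Multiset.induction_on with
  | empty => simp [pairMonomial, leadExp]
  | cons p s ih =>
    rw [pairMonomial_cons, map_mul, map_mul, Polynomial.leadingCoeff_mul,
      ih fun q hq => hs q (Multiset.mem_cons_of_mem hq)]
    have : bracketHom A (X p) = bracket p.1 p.2 := by simp [bracketHom]
    rw [this, (degeneration_bracket w hw (hs p (Multiset.mem_cons_self _ _))).1, X, X, monomial_mul,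
      monomial_mul]
    congr 1
    · simp only [leadExp, Multiset.map_cons]
      simp only [← Multiset.singleton_add, map_add, Multiset.toFinsupp_singleton]
      congr 1
      abel
    · simp

/-- The exponents of the first and of the second coordinates recover the multisets of first and of
second entries. -/
theorem IsStandard.leadExp_injective {s t : Multiset (A × A)} (hs : IsStandard s)
    (ht : IsStandard t) (h : leadExp s = leadExp t) : s = t := by
  rw [leadExp, leadExp, ← map_add, ← map_add, EmbeddingLike.apply_eq_iff_eq] at h
  have key (k : Fin 2) := congrArg (fun m : Multiset (A × Fin 2) =>
    (m.filter fun p => p.2 = k).map Prod.fst) h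
  have h0 := key 0
  have h1 := key 1
  simp [Multiset.filter_add, Multiset.filter_map] at h0 h1
  exact hs.eq_of_map_eq ht h0 h1

/-- In a vanishing combination, take a term with nonzero coefficient of highest degree in the
parameter. No other term contributes to its leading monomial in that degree, so its coefficient must
vanish. -/
theorem linearIndependent_standard (w : A → ℕ) (hw : StrictMono w) :
    LinearIndependent ℂ ((bracketHom A).toLinearMap ∘
      fun s : {s : Multiset (A × A) // IsStandard s} => pairMonomial s.1) := by
  classical
  set v : {s : Multiset (A × A) // IsStandard s} → Polynomial (VecRing A) :=
    fun s => degeneration w (bracketHom A (pairMonomial s.1)) with hv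
  rw [linearIndependent_iff']
  intro T g hg
  by_contra! hne
  obtain ⟨i, hi, hgi⟩ := hne
  obtain ⟨j, hj, hmax⟩ := (T.filter fun i => g i ≠ 0).exists_max_image (fun i => (v i).natDegree)
    ⟨i, by simp [hi, hgi]⟩
  rw [Finset.mem_filter] at hj
  have h : ∑ i ∈ T, g i • v i = 0 := by
    have := congrArg (degeneration w) hg
    simpa [map_sum, map_smul, hv] using this
  have h' := congrArg (fun p => coeff (leadExp j.1) (Polynomial.coeff p (v j).natDegree)) h
  simp only [Polynomial.finsetSum_coeff, Polynomial.coeff_smul, coeff_sum, coeff_smul,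
    Polynomial.coeff_zero, coeff_zero] at h'
  rw [Finset.sum_eq_single_of_mem j hj.1] at h'
  · change g j • coeff _ (v j).leadingCoeff = 0 at h'
    rw [hv, degeneration_leadingCoeff w hw j.2.1] at h'
    simp at h'
    exact hj.2 h'
  · intro k hk hkj
    by_cases hgk : g k = 0
    · rw [hgk, zero_smul]
    rcases (hmax k (Finset.mem_filter.2 ⟨hk, hgk⟩)).lt_or_eq with hlt | heq
    · rw [Polynomial.coeff_eq_zero_of_natDegree_lt hlt, coeff_zero, smul_zero]
    · rw [← heq]
      change g k • coeff _ (v k).leadingCoeff = 0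
      rw [hv, degeneration_leadingCoeff w hw k.2.1, coeff_monomial, if_neg, smul_zero]
      exact fun h => hkj (Subtype.ext (k.2.leadExp_injective j.2 h))

/-- The second fundamental theorem for `SL_2`. -/
theorem ker_bracketHom (w : A → ℕ) (hw : StrictMono w) :
    RingHom.ker (bracketHom A) = relIdeal A := by
  refine le_antisymm (fun f hf => ?_) relIdeal_le_ker
  have hf' : f ∈ straightSpan A := by rw [straightSpan_eq_top w hw]; trivial
  obtain ⟨g, hg, r, hr, rfl⟩ := Submodule.mem_sup.1 hf'
  have hg0 : bracketHom A g = 0 := by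
    have hr0 : bracketHom A r = 0 := relIdeal_le_ker hr
    have : bracketHom A (g + r) = 0 := hf
    rwa [map_add, hr0, add_zero] at this
  have hz := (Submodule.disjoint_def.1
    (Submodule.range_ker_disjoint (linearIndependent_standard w hw))) g hg hg0
  rw [hz, zero_add]
  exact hr

end Straightening

/-! ### Invariants in the ideal of the fibre, by contraction of auxiliary vectors -/

section Covariants

variable {A ι : Type} [Fintype ι]

/-- Setting two auxiliary vectors to zero. -/
noncomputable def killAux : VecRing (A ⊕ Fin 2) →ₐ[ℂ] VecRing A :=
  aeval fun p => Sum.elim (fun a => X (a, p.2)) (fun _ => 0) p.1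

@[simp] theorem killAux_inl (a : A) (k : Fin 2) :
    killAux (X (Sum.inl a, k) : VecRing (A ⊕ Fin 2)) = X (a, k) := by simp [killAux]

@[simp] theorem killAux_inr (a k : Fin 2) :
    killAux (X (Sum.inr a, k) : VecRing (A ⊕ Fin 2)) = 0 := by simp [killAux]

theorem killAux_pol (i j : Fin 2) (p : VecRing (A ⊕ Fin 2)) :
    killAux (pol i j p) = pol i j (killAux p) := by
  induction p using MvPolynomial.induction_on with
  | C a => simp [killAux]
  | add p q hp hq => simp [hp, hq]
  | mul_X p x hp =>
    obtain ⟨a | a, k⟩ := x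
    · simp only [Derivation.leibniz, pol_X, map_add, smul_eq_mul, map_mul, killAux_inl, hp,
        apply_ite killAux, map_zero]
    · simp only [Derivation.leibniz, pol_X, map_add, smul_eq_mul, map_mul, killAux_inr, hp,
        apply_ite killAux, map_zero]
      simp

/-- The coefficient of `y_k z_l` for the auxiliary vectors `y` and `z`. -/
noncomputable def auxCoeff (k l : Fin 2) : VecRing (A ⊕ Fin 2) →ₗ[ℂ] VecRing A :=
  killAux.toLinearMap ∘ₗ (pderiv (Sum.inr 0, k)).toLinearMap ∘ₗ
    (pderiv (Sum.inr 1, l)).toLinearMap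

theorem auxCoeff_apply (k l : Fin 2) (p : VecRing (A ⊕ Fin 2)) :
    auxCoeff k l p = killAux (pderiv (Sum.inr 0, k) (pderiv (Sum.inr 1, l) p)) := rfl

theorem auxCoeff_pol (i j k l : Fin 2) (p : VecRing (A ⊕ Fin 2)) :
    auxCoeff k l (pol i j p) = pol i j (auxCoeff k l p) +
      (if i = k then auxCoeff j l p else 0) + if i = l then auxCoeff k j p else 0 := by
  classical
  simp only [auxCoeff_apply, pderiv_pol, map_add, killAux_pol]
  split_ifs <;> simp

/-- Contraction of a matrix of functions with the coefficients of the `y_k z_l`. -/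
noncomputable def contract (m : Fin 2 → Fin 2 → VecRing A) :
    VecRing (A ⊕ Fin 2) →ₗ[ℂ] VecRing A :=
  ∑ k, ∑ l, LinearMap.mulLeft ℂ (m k l) ∘ₗ auxCoeff k l

theorem contract_apply (m : Fin 2 → Fin 2 → VecRing A) (p : VecRing (A ⊕ Fin 2)) :
    contract m p = ∑ k, ∑ l, m k l * auxCoeff k l p := by
  simp [contract]

/-- By `hm` the matrix transforms like a tensor of two vectors, dually to the coefficients in
`auxCoeff_pol`, so the shifts cancel. -/
theorem contract_pol {i j : Fin 2} {m : Fin 2 → Fin 2 → VecRing A}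
    (hm : ∀ k l, pol i j (m k l) = (if k = j then m i l else 0) + if l = j then m k i else 0)
    (p : VecRing (A ⊕ Fin 2)) : contract m (pol i j p) = pol i j (contract m p) := by
  simp only [contract_apply, auxCoeff_pol, map_add, Derivation.leibniz, hm, smul_eq_mul,
    Fin.sum_univ_two]
  clear hm
  fin_cases i <;> fin_cases j <;> simp <;> ring

/-- Reduces the Cartan element to off-diagonal operators. The constant `c ω` in `momentForm` obeys
the tensor law for these, but not for `pol 0 0` or `pol 1 1` when `c ≠ 0`. -/
theorem cartan_eq (f : VecRing A) :
    cartan f = pol 0 1 (pol 1 0 f) - pol 1 0 (pol 0 1 f) := by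
  rw [pol_pol 0 1 1 0, cartan_apply]
  simp
  ring

theorem contract_casimir {m : Fin 2 → Fin 2 → VecRing A}
    (hm : ∀ i j, i ≠ j → ∀ k l,
      pol i j (m k l) = (if k = j then m i l else 0) + if l = j then m k i else 0)
    (p : VecRing (A ⊕ Fin 2)) : contract m (casimir p) = casimir (contract m p) := by
  have h1 := contract_pol (hm 0 1 (by decide))
  have h2 := contract_pol (hm 1 0 (by decide))
  have h3 (p) : contract m (cartan p) = cartan (contract m p) := by
    simp only [cartan_eq, map_sub, h1, h2]
  have h {B : Type} (f : VecRing B) : casimir f = (4 : ℂ) • pol 0 1 (pol 1 0 f) +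
    cartan (cartan f) - (2 : ℂ) • cartan f := rfl
  simp only [h, map_sub, map_add, map_smul, h1, h2, h3]

theorem contract_aeval_casimir {m : Fin 2 → Fin 2 → VecRing A}
    (hm : ∀ i j, i ≠ j → ∀ k l,
      pol i j (m k l) = (if k = j then m i l else 0) + if l = j then m k i else 0)
    (q : Polynomial ℂ) (p : VecRing (A ⊕ Fin 2)) :
    contract m (Polynomial.aeval casimir q p) = Polynomial.aeval casimir q (contract m p) := by
  induction q using Polynomial.induction_on' with
  | add q r hq hr => simp [hq, hr]
  | monomial n c =>
    have : ∀ n p, contract m (((casimir : Module.End ℂ (VecRing (A ⊕ Fin 2))) ^ n) p) =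
        ((casimir : Module.End ℂ (VecRing A)) ^ n) (contract m p) := by
      intro n
      induction n with
      | zero => simp
      | succ n ih => intro p; simp [pow_succ, contract_casimir hm, ih]
    simp [Polynomial.aeval_monomial, this]

/-- The matrix of the bilinear form `∑ i, u_i ⊗ v_i + c ω`. -/
noncomputable def momentForm (u v : ι → A) (c : ℂ) (k l : Fin 2) : VecRing A :=
  ∑ i, X (u i, k) * X (v i, l) + C (c * !![0, 1; -1, 0] k l)

theorem pol_momentForm (u v : ι → A) (c : ℂ) (i j : Fin 2) (hij : i ≠ j) (k l : Fin 2) :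
    pol i j (momentForm u v c k l) = (if k = j then momentForm u v c i l else 0) +
      if l = j then momentForm u v c k i else 0 := by
  simp only [momentForm, map_add, map_sum, Derivation.leibniz, pol_X, derivation_C, smul_eq_mul,
    Finset.sum_add_distrib]
  fin_cases i <;> fin_cases j <;> simp at hij <;> fin_cases k <;> fin_cases l <;>
    simp [mul_comm] <;> ring

/-- The functions generating the ideal of the fibre of the moment map among invariants, as a
module over the invariants. -/
noncomputable def invRelations (u v : ι → A) (c : ℂ) (d : ι → ℂ) :
    Submodule (bracketAlg A) (VecRing A) :=
  Submodule.span (bracketAlg A)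
    ((Set.range fun i => bracket (u i) (v i) + C (d i)) ∪
     (Set.range fun p : A × A =>
        ∑ i, bracket (u i) p.1 * bracket (v i) p.2 + C c * bracket p.1 p.2))

/-- The vector-valued functions `ω(u_b, -)`. -/
noncomputable def covector (b : A) : Fin 2 → VecRing A := ![-X (b, 1), X (b, 0)]

/-- The gradient at zero with respect to an auxiliary vector. -/
noncomputable def auxGrad (e : Fin 2) (p : VecRing (A ⊕ Fin 2)) (k : Fin 2) : VecRing A :=
  killAux (pderiv (Sum.inr e, k) p)

theorem killAux_bracket_mem (x y : A ⊕ Fin 2) : killAux (bracket x y) ∈ bracketAlg A := by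
  rcases x with a | a <;> rcases y with b | b
  · simpa [bracket_eq] using bracket_mem a b
  all_goals simp [bracket_eq]

/-- At `y = z = 0` only brackets of an original with an auxiliary vector have a nonzero gradient,
namely `±covector`; the gradient of `[y z]` is linear in the vanishing other vector. -/
theorem auxGrad_bracket_mem (e : Fin 2) (x y : A ⊕ Fin 2) :
    auxGrad e (bracket x y) ∈ Submodule.span (bracketAlg A) (Set.range (covector (A := A))) := by
  classical
  have h (e : Fin 2) (x : A) (y : Fin 2) : auxGrad e (bracket (Sum.inl x) (Sum.inr y)) =
      if y = e then covector x else 0 := by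
    funext k
    by_cases h : y = e
    · fin_cases k <;> simp [auxGrad, bracket_eq, pderiv_X, h, covector]
    · simp [auxGrad, bracket_eq, pderiv_X, h]
  have hsymm (x y : A ⊕ Fin 2) : auxGrad e (bracket x y) = -auxGrad e (bracket y x) := by
    funext k
    rw [Pi.neg_apply, auxGrad, auxGrad, ← map_neg, ← map_neg]
    congr 2
    rw [bracket_eq, bracket_eq]
    ring
  have hm (e : Fin 2) (x : A) (y : Fin 2) : auxGrad e (bracket (Sum.inl x) (Sum.inr y)) ∈
      Submodule.span (bracketAlg A) (Set.range (covector (A := A))) := by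
    rw [h]
    split_ifs
    · exact Submodule.subset_span ⟨x, rfl⟩
    · exact zero_mem _
  rcases x with a | a <;> rcases y with b | b
  · have : auxGrad e (bracket (Sum.inl a : A ⊕ Fin 2) (Sum.inl b)) = 0 := by
      funext k
      simp [auxGrad, bracket_eq, pderiv_X]
    rw [this]
    exact zero_mem _
  · exact hm e a b
  · rw [hsymm]
    exact neg_mem (hm e b a)
  · have : auxGrad e (bracket (Sum.inr a : A ⊕ Fin 2) (Sum.inr b)) = 0 := by
      funext k
      simp only [auxGrad, bracket_eq, pderiv_X, map_sub, Derivation.leibniz, smul_eq_mul, map_add,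
        map_mul, killAux_inr, zero_mul, add_zero, sub_zero, Pi.zero_apply]
    rw [this]
    exact zero_mem _

/-- Only `[y z]`, up to sign, contributes: it contracts to the trace `∑ [u_i v_i] + 2c`, which by
`hd` is the sum of the relations `[u_i v_i] + d_i`. -/
theorem contract_bracket_mem (u v : ι → A) (c : ℂ) (d : ι → ℂ) (hd : ∑ i, d i = 2 * c)
    (x y : A ⊕ Fin 2) :
    contract (momentForm u v c) (bracket x y) ∈ invRelations u v c d := by
  classical
  have htr : ∑ i, bracket (u i) (v i) + C (2 * c) ∈ invRelations u v c d := by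
    rw [← hd, map_sum, ← Finset.sum_add_distrib]
    exact sum_mem fun i _ => Submodule.subset_span (Or.inl ⟨i, rfl⟩)
  have hsymm (x y : A ⊕ Fin 2) : contract (momentForm u v c) (bracket x y) =
      -contract (momentForm u v c) (bracket y x) := by
    rw [← map_neg]
    congr 1
    rw [bracket_eq, bracket_eq]
    ring
  have h01 : contract (momentForm u v c) (bracket (Sum.inr 0) (Sum.inr 1)) =
      ∑ i, bracket (u i) (v i) + C (2 * c) := by
    simp [contract_apply, auxCoeff_apply, bracket_eq, pderiv_X, Pi.single_apply, momentForm,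
      Fin.sum_univ_two, Finset.sum_sub_distrib]
    linear_combination (-(C c)) * (map_ofNat C 2 : (C 2 : VecRing A) = 2)
  have hmix (a : A) (b : Fin 2) :
      contract (momentForm u v c) (bracket (Sum.inl a) (Sum.inr b)) = 0 := by
    fin_cases b <;>
      simp [contract_apply, auxCoeff_apply, bracket_eq, pderiv_X, Pi.single_apply, Fin.sum_univ_two]
  rcases x with a | a <;> rcases y with b | b
  · have : contract (momentForm u v c) (bracket (Sum.inl a) (Sum.inl b)) = 0 := by
      simp [contract_apply, auxCoeff_apply, bracket_eq, pderiv_X]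
    rw [this]
    exact zero_mem _
  · rw [hmix]
    exact zero_mem _
  · rw [hsymm, hmix, neg_zero]
    exact zero_mem _
  · have h0 (a : A ⊕ Fin 2) : contract (momentForm u v c) (bracket a a) = 0 := by
      rw [bracket_eq, mul_comm, sub_self, map_zero]
    fin_cases a <;> fin_cases b <;> simp only [Fin.mk_one, Fin.zero_eta, h0, zero_mem]
    · rw [h01]; exact htr
    · rw [hsymm, h01]; exact neg_mem htr

/-- The bilinear form `∑ i, u_i ⊗ v_i + c ω` on covectors. -/
noncomputable def pairing (u v : ι → A) (c : ℂ) (x y : Fin 2 → VecRing A) : VecRing A :=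
  ∑ k, ∑ l, momentForm u v c k l * (x k * y l)

theorem pairing_covector (u v : ι → A) (c : ℂ) (a b : A) :
    pairing u v c (covector a) (covector b) =
      ∑ i, bracket (u i) a * bracket (v i) b + C c * bracket a b := by
  simp only [pairing, covector, momentForm, Fin.sum_univ_two, bracket_eq, add_mul,
    Finset.sum_mul]
  simp
  have (i : ι) : (X (u i, 0) * X (a, 1) - X (u i, 1) * X (a, 0)) *
      (X (v i, 0) * X (b, 1) - X (v i, 1) * X (b, 0)) =
      (X (u i, 0) * X (v i, 0) * (X (a, 1) * X (b, 1)) -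
      X (u i, 0) * X (v i, 1) * (X (a, 1) * X (b, 0)) -
      X (u i, 1) * X (v i, 0) * (X (a, 0) * X (b, 1)) +
      X (u i, 1) * X (v i, 1) * (X (a, 0) * X (b, 0)) : VecRing A) := by ring
  simp only [this, Finset.sum_add_distrib, Finset.sum_sub_distrib]
  ring

theorem pairing_mem (u v : ι → A) (c : ℂ) (d : ι → ℂ) {x y : Fin 2 → VecRing A}
    (hx : x ∈ Submodule.span (bracketAlg A) (Set.range (covector (A := A))))
    (hy : y ∈ Submodule.span (bracketAlg A) (Set.range (covector (A := A)))) :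
    pairing u v c x y ∈ invRelations u v c d := by
  have addl (x x' y) : pairing u v c (x + x') y = pairing u v c x y + pairing u v c x' y := by
    simp [pairing, add_mul, mul_add, Finset.sum_add_distrib]
  have addr (x y y') : pairing u v c x (y + y') = pairing u v c x y + pairing u v c x y' := by
    simp [pairing, mul_add, Finset.sum_add_distrib]
  have smull (r : bracketAlg A) (x y) : pairing u v c (r • x) y = r • pairing u v c x y := by
    simp only [pairing, Finset.smul_sum, Pi.smul_apply, Subalgebra.smul_def, smul_eq_mul]
    exact Finset.sum_congr rfl fun k _ => Finset.sum_congr rfl fun l _ => by ring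
  have smulr (r : bracketAlg A) (x y) : pairing u v c x (r • y) = r • pairing u v c x y := by
    simp only [pairing, Finset.smul_sum, Pi.smul_apply, Subalgebra.smul_def, smul_eq_mul]
    exact Finset.sum_congr rfl fun k _ => Finset.sum_congr rfl fun l _ => by ring
  induction hx using Submodule.span_induction with
  | mem x hx =>
    obtain ⟨a, rfl⟩ := hx
    induction hy using Submodule.span_induction with
    | mem y hy =>
      obtain ⟨b, rfl⟩ := hy
      rw [pairing_covector]
      exact Submodule.subset_span (Or.inr ⟨(a, b), rfl⟩)
    | zero => simp [pairing]
    | add x y _ _ hx hy => rw [addr]; exact add_mem hx hy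
    | smul r x _ hx => rw [smulr]; exact Submodule.smul_mem _ _ hx
  | zero => simp [pairing]
  | add x y _ _ hx hy => rw [addl]; exact add_mem hx hy
  | smul r x _ hx => rw [smull]; exact Submodule.smul_mem _ _ hx

/-- Contraction maps invariants of the extended family of vectors to the module of relations. -/
theorem contract_mem (u v : ι → A) (c : ℂ) (d : ι → ℂ) (hd : ∑ i, d i = 2 * c)
    {p : VecRing (A ⊕ Fin 2)} (hp : p ∈ bracketAlg (A ⊕ Fin 2)) :
    contract (momentForm u v c) p ∈ invRelations u v c d := by
  -- Value and gradients at zero are carried along because the product rule needs them: the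
  -- derivatives in `y` and `z` hit the same factor or one factor each.
  have key : killAux p ∈ bracketAlg A ∧
      (∀ e, auxGrad e p ∈ Submodule.span (bracketAlg A) (Set.range (covector (A := A)))) ∧
      contract (momentForm u v c) p ∈ invRelations u v c d := by
    induction hp using Algebra.adjoin_induction with
    | mem x hx =>
      obtain ⟨⟨a, b⟩, rfl⟩ := hx
      exact ⟨killAux_bracket_mem a b, fun e => auxGrad_bracket_mem e a b,
        contract_bracket_mem u v c d hd a b⟩
    | algebraMap r =>
      refine ⟨?_, fun e => ?_, ?_⟩
      · rw [AlgHom.commutes]; exact Subalgebra.algebraMap_mem _ _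
      · have : auxGrad e (algebraMap ℂ (VecRing (A ⊕ Fin 2)) r) = 0 := by
          funext k
          simp [auxGrad]
        rw [this]
        exact zero_mem _
      · have : contract (momentForm u v c) (algebraMap ℂ (VecRing (A ⊕ Fin 2)) r) = 0 := by
          simp [contract_apply, auxCoeff_apply]
        rw [this]
        exact zero_mem _
    | add x y _ _ hx hy =>
      refine ⟨?_, fun e => ?_, ?_⟩
      · rw [map_add]; exact add_mem hx.1 hy.1
      · have : auxGrad e (x + y) = auxGrad e x + auxGrad e y := by
          funext k; simp [auxGrad]
        rw [this]; exact add_mem (hx.2.1 e) (hy.2.1 e)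
      · rw [map_add]; exact add_mem hx.2.2 hy.2.2
    | mul x y _ _ hx hy =>
      refine ⟨?_, fun e => ?_, ?_⟩
      · rw [map_mul]; exact mul_mem hx.1 hy.1
      · have : auxGrad e (x * y) = (⟨_, hx.1⟩ : bracketAlg A) • auxGrad e y +
            (⟨_, hy.1⟩ : bracketAlg A) • auxGrad e x := by
          funext k; simp [auxGrad, Subalgebra.smul_def]
        rw [this]
        exact add_mem (Submodule.smul_mem _ _ (hy.2.1 e)) (Submodule.smul_mem _ _ (hx.2.1 e))
      · have : contract (momentForm u v c) (x * y) =
            (⟨_, hx.1⟩ : bracketAlg A) • contract (momentForm u v c) y +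
            (⟨_, hy.1⟩ : bracketAlg A) • contract (momentForm u v c) x +
            pairing u v c (auxGrad 0 x) (auxGrad 1 y) +
            pairing u v c (auxGrad 0 y) (auxGrad 1 x) := by
          simp only [contract_apply, pairing, auxCoeff_apply, auxGrad, Subalgebra.smul_def,
            Finset.smul_sum, ← Finset.sum_add_distrib, Derivation.leibniz, map_add, smul_eq_mul,
            map_mul]
          exact Finset.sum_congr rfl fun k _ => Finset.sum_congr rfl fun l _ => by ring
        rw [this]
        exact add_mem (add_mem (add_mem (Submodule.smul_mem _ _ hy.2.2)
          (Submodule.smul_mem _ _ hx.2.2)) (pairing_mem u v c d (hx.2.1 0) (hy.2.1 1)))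
          (pairing_mem u v c d (hy.2.1 0) (hx.2.1 1))
  exact key.2.2

/-- The ideal of the fibre of the moment map. -/
noncomputable def fibreIdeal (u v : ι → A) (c : ℂ) (d : ι → ℂ) : Ideal (VecRing A) :=
  Ideal.span (Set.range fun p : Fin 2 × Fin 2 => momentForm u v c p.1 p.2) ⊔
    Ideal.span (Set.range fun i => bracket (u i) (v i) + C (d i))

theorem pol_mem_fibreIdeal (u v : ι → A) (c : ℂ) (d : ι → ℂ) {i j : Fin 2} (hij : i ≠ j)
    {f : VecRing A} (hf : f ∈ fibreIdeal u v c d) : pol i j f ∈ fibreIdeal u v c d := by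
  have hm (k l) : momentForm u v c k l ∈ fibreIdeal u v c d :=
    Ideal.mem_sup_left (Ideal.subset_span ⟨(k, l), rfl⟩)
  rw [fibreIdeal, ← Ideal.span_union] at hf
  induction hf using Submodule.span_induction with
  | mem x hx =>
    rcases hx with ⟨⟨k, l⟩, rfl⟩ | ⟨a, rfl⟩
    · simp only
      rw [pol_momentForm u v c i j hij]
      refine add_mem ?_ ?_
      · split_ifs
        exacts [hm _ _, zero_mem _]
      · split_ifs
        exacts [hm _ _, zero_mem _]
    · have h := pol_bracket (u a) (v a)
      have : pol i j (bracket (u a) (v a) + C (d a)) = 0 := by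
        rw [map_add, derivation_C, add_zero]
        fin_cases i <;> fin_cases j <;> simp at hij
        exacts [h.1, h.2.1]
      simp only [this, zero_mem]
  | zero => simp
  | add x y _ _ hx hy => rw [map_add]; exact add_mem hx hy
  | smul r x hx0 hx =>
    rw [smul_eq_mul, Derivation.leibniz]
    refine add_mem (Ideal.mul_mem_left _ _ hx) ?_
    rw [smul_eq_mul]
    refine Ideal.mul_mem_right _ _ ?_
    rwa [fibreIdeal, ← Ideal.span_union]

theorem invRelations_le_fibreIdeal (u v : ι → A) (c : ℂ) (d : ι → ℂ) {f : VecRing A}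
    (hf : f ∈ invRelations u v c d) : f ∈ fibreIdeal u v c d := by
  induction hf using Submodule.span_induction with
  | mem x hx =>
    rcases hx with ⟨a, rfl⟩ | ⟨⟨a, b⟩, rfl⟩
    · exact Ideal.mem_sup_right (Ideal.subset_span ⟨a, rfl⟩)
    · simp only
      rw [← pairing_covector]
      refine sum_mem fun k _ => sum_mem fun l _ => Ideal.mul_mem_right _ _ ?_
      exact Ideal.mem_sup_left (Ideal.subset_span ⟨(k, l), rfl⟩)
  | zero => exact zero_mem _
  | add x y _ _ hx hy => exact add_mem hx hy
  | smul r x _ hx => exact Ideal.mul_mem_left _ _ hx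

theorem casimir_mem_of_pol_mem {I : Ideal (VecRing A)}
    (hI : ∀ i j, i ≠ j → ∀ f ∈ I, pol i j f ∈ I) {f : VecRing A}
    (hf : ∀ i j, i ≠ j → pol i j f ∈ I) : casimir f ∈ I := by
  have h1 := hI 0 1 (by decide)
  have h2 := hI 1 0 (by decide)
  have hc : cartan f ∈ I := by
    rw [cartan_eq]
    exact sub_mem (h1 _ (hf 1 0 (by decide))) (h2 _ (hf 0 1 (by decide)))
  rw [casimir_apply]
  refine sub_mem (add_mem (Ideal.mul_mem_left _ _ (h1 _ (hf 1 0 (by decide)))) ?_)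
    (Ideal.mul_mem_left _ _ hc)
  rw [cartan_eq]
  exact sub_mem (h1 _ (h2 _ hc)) (h2 _ (h1 _ hc))

/-- A function whose class modulo a stable ideal is invariant is congruent to an invariant. -/
theorem exists_mem_bracketAlg_sub_mem [Fintype A] {I : Ideal (VecRing A)}
    (hI : ∀ i j, i ≠ j → ∀ f ∈ I, pol i j f ∈ I) {f : VecRing A}
    (hf : ∀ i j, i ≠ j → pol i j f ∈ I) : ∃ g ∈ bracketAlg A, f - g ∈ I := by
  obtain ⟨q, h0, hq⟩ := hasReynolds f
  have hst {g : VecRing A} (hg : g ∈ I) : casimir g ∈ I :=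
    casimir_mem_of_pol_mem hI fun i j hij => hI i j hij g hg
  have hcas := casimir_mem_of_pol_mem hI hf
  -- Since `I` contains `casimir f` and is stable under the Casimir operator, `q(casimir)` acts on
  -- `f` modulo `I` as `q(0)`.
  have key (q : Polynomial ℂ) : Polynomial.aeval casimir q f - q.coeff 0 • f ∈ I := by
    have e : Polynomial.aeval casimir q f =
        Polynomial.aeval casimir q.divX (casimir f) + q.coeff 0 • f := by
      conv_lhs => rw [← Polynomial.divX_mul_X_add q]
      simp
    rw [e, add_sub_cancel_right]
    generalize q.divX = s
    induction s using Polynomial.induction_on' with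
    | add p q hp hq => rw [map_add]; exact add_mem hp hq
    | monomial n a =>
      rw [Polynomial.aeval_monomial, Module.End.mul_apply, Module.algebraMap_end_apply,
        Algebra.smul_def]
      refine Ideal.mul_mem_left _ _ ?_
      induction n with
      | zero => simpa using hcas
      | succ n ih => rw [pow_succ', Module.End.mul_apply]; exact hst ih
  refine ⟨(q.coeff 0)⁻¹ • Polynomial.aeval casimir q f,
    Subalgebra.smul_mem _ (mem_bracketAlg_of_casimir_eq_zero hq) _, ?_⟩
  have : f - (q.coeff 0)⁻¹ • Polynomial.aeval casimir q f =
      C (-(q.coeff 0)⁻¹) * (Polynomial.aeval casimir q f - q.coeff 0 • f) := by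
    rw [← smul_eq_C_mul, smul_sub, smul_smul, neg_mul, inv_mul_cancel₀ h0, neg_smul,
      neg_smul, one_smul]
    abel
  rw [this]
  exact Ideal.mul_mem_left _ _ (key q)

theorem aeval_casimir_of_mem {f : VecRing A} (hf : f ∈ bracketAlg A) (q : Polynomial ℂ) :
    Polynomial.aeval casimir q f = q.coeff 0 • f := by
  have h0 : casimir f = 0 := by
    obtain ⟨h1, h2, h3⟩ := casimir_of_mem_bracketAlg hf
    simp [casimir_apply, h2, h3]
  conv_lhs => rw [← Polynomial.divX_mul_X_add q]
  simp [h0]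

theorem mem_invRelations_of_mem_fibreIdeal [Fintype A] (u v : ι → A) (c : ℂ) (d : ι → ℂ)
    (hd : ∑ i, d i = 2 * c) {f : VecRing A} (hf : f ∈ bracketAlg A)
    (hfI : f ∈ fibreIdeal u v c d) : f ∈ invRelations u v c d := by
  classical
  obtain ⟨x, hx, y, hy, rfl⟩ := Submodule.mem_sup.1 hfI
  obtain ⟨g, rfl⟩ := Ideal.mem_span_range_iff_exists_fun.1 hx
  obtain ⟨h, rfl⟩ := Ideal.mem_span_range_iff_exists_fun.1 hy
  let emb : VecRing A →ₐ[ℂ] VecRing (A ⊕ Fin 2) := rename fun p => (Sum.inl p.1, p.2)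
  have hemb (x : VecRing A) : killAux (emb x) = x := by
    have : (killAux.comp emb : VecRing A →ₐ[ℂ] VecRing A) = AlgHom.id ℂ _ := by
      ext ⟨a, k⟩
      simp [emb]
    exact DFunLike.congr_fun this x
  have hpd (e k : Fin 2) (x : VecRing A) : pderiv (Sum.inr e, k) (emb x) = 0 := by
    refine pderiv_eq_zero_of_notMem_vars fun hv => ?_
    obtain ⟨p, -, hp⟩ := Finset.mem_image.1 (vars_rename _ _ hv)
    simp at hp
  -- The coefficients `g` become those of a bilinear form in the auxiliary vectors, so that `P` can
  -- be made invariant even though the individual `g p` cannot.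
  let P : VecRing (A ⊕ Fin 2) := ∑ p : Fin 2 × Fin 2,
    emb (g p) * (X (Sum.inr 0, p.1) * X (Sum.inr 1, p.2))
  have hP : contract (momentForm u v c) P =
      ∑ p : Fin 2 × Fin 2, g p * momentForm u v c p.1 p.2 := by
    simp [P, contract_apply, auxCoeff_apply, pderiv_X, Pi.single_apply, Fintype.sum_prod_type,
      Fin.sum_univ_two, hpd, hemb]
    ring
  obtain ⟨q, hq0, hq⟩ := exists_common_reynolds Finset.univ h fun i _ => hasReynolds _
  obtain ⟨r, hr0, hr⟩ := hasReynolds P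
  -- Applying `(q * r)(casimir)` to both sides multiplies `f` by `q(0) r(0)` and makes `P` and all
  -- the `h i` invariant.
  have e := aeval_casimir_of_mem hf (q * r)
  rw [map_add, ← hP, ← contract_aeval_casimir (pol_momentForm u v c), hP] at e
  rw [eq_comm, ← eq_inv_smul_iff₀ (by simp [Polynomial.mul_coeff_zero, hq0, hr0])] at e
  rw [e, ← algebraMap_smul (bracketAlg A)]
  refine Submodule.smul_mem _ _ (add_mem ?_ ?_)
  · refine contract_mem u v c d hd (mem_bracketAlg_of_casimir_eq_zero ?_)
    rw [mul_comm]
    exact casimir_aeval_mul _ _ hr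
  · rw [map_sum]
    refine sum_mem fun i _ => ?_
    have hi : bracket (u i) (v i) + C (d i) ∈ bracketAlg A :=
      add_mem (bracket_mem _ _) (Subalgebra.algebraMap_mem _ _)
    rw [mul_comm (h i), aeval_casimir_mul_of_mem hi, mul_comm (bracket _ _ + _)]
    exact Submodule.smul_mem _ (⟨_, mem_bracketAlg_of_casimir_eq_zero
      (casimir_aeval_mul _ r (hq i (Finset.mem_univ i)))⟩ : bracketAlg A)
      (Submodule.subset_span (Or.inl ⟨i, rfl⟩))

end Covariants

/-! ### From one-parameter unipotent groups to derivations -/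

section Unipotent

/-- If all values at constants of a polynomial lie in a subspace, then so do its coefficients. -/
theorem coeff_mem_of_eval_mem {S : Type*} [CommRing S] [Algebra ℂ S] (W : Submodule ℂ S)
    (P : Polynomial S) (hP : ∀ t : ℂ, P.eval (algebraMap ℂ S t) ∈ W) (k : ℕ) : P.coeff k ∈ W := by
  by_contra h
  -- A functional that kills `W` but not the coefficient turns `P` into a complex polynomial
  -- vanishing at every point.
  obtain ⟨l, hl, hW⟩ := Submodule.exists_le_ker_of_notMem h
  let Q : Polynomial ℂ := ∑ i ∈ P.support, Polynomial.monomial i (l (P.coeff i))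
  have hQ : Q = 0 := by
    refine Polynomial.funext fun t => ?_
    have := LinearMap.mem_ker.1 (hW (hP t))
    rw [Polynomial.eval_eq_sum, Polynomial.sum, map_sum] at this
    rw [Polynomial.eval_zero, ← this, Polynomial.eval_finsetSum]
    refine Finset.sum_congr rfl fun i _ => ?_
    rw [← map_pow, mul_comm, ← Algebra.smul_def, map_smul, Polynomial.eval_monomial, smul_eq_mul,
      mul_comm]
  have hk := congrArg (fun q => Polynomial.coeff q k) hQ
  simp only [Q, Polynomial.finsetSum_coeff, Polynomial.coeff_monomial, Finset.sum_ite_eq',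
    Polynomial.coeff_zero] at hk
  split_ifs at hk with hs
  · exact hl hk
  · rw [Polynomial.notMem_support_iff.1 hs, map_zero] at hl
    exact hl rfl

variable {A : Type}

/-- The action on functions of the one-parameter unipotent subgroup generated by `pol i j`. -/
noncomputable def shear (i j : Fin 2) : VecRing A →ₐ[ℂ] Polynomial (VecRing A) :=
  aeval fun p => Polynomial.C (X p) + Polynomial.X * Polynomial.C (pol i j (X p))

theorem shear_coeff (i j : Fin 2) (f : VecRing A) :
    (shear i j f).coeff 0 = f ∧ (shear i j f).coeff 1 = pol i j f := by
  induction f using MvPolynomial.induction_on with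
  | C a =>
    rw [shear, algHom_C, Polynomial.algebraMap_apply, derivation_C]
    simp [Polynomial.coeff_C]
  | add p q hp hq => simp [hp, hq]
  | mul_X p x hp =>
    have h0 : (shear i j (X x : VecRing A)).coeff 0 = X x := by simp [shear]
    have h1 : (shear i j (X x : VecRing A)).coeff 1 = pol i j (X x) := by
      simp [shear, Polynomial.coeff_C]
    rw [map_mul, Polynomial.mul_coeff_zero, Polynomial.mul_coeff_one, h0, h1, hp.1, hp.2,
      Derivation.leibniz]
    refine ⟨rfl, ?_⟩
    simp only [smul_eq_mul]
    ring

/-- The derivation is the linear coefficient in `t`, so invariance modulo `I` for all `t` gives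
infinitesimal invariance. -/
theorem pol_mem_of_shear_mem {I : Ideal (VecRing A)} {i j : Fin 2} {f : VecRing A}
    (h : ∀ t : ℂ, (shear i j f).eval (C t) - f ∈ I) : pol i j f ∈ I := by
  have := coeff_mem_of_eval_mem (I.restrictScalars ℂ) (shear i j f - Polynomial.C f)
    (fun t => by simpa using h t) 1
  rw [Polynomial.coeff_sub, (shear_coeff i j f).2, Polynomial.coeff_C, if_neg one_ne_zero,
    sub_zero] at this
  exact this

end Unipotent

/-! ### Translation to quiver representations; proofs of (i) and (ii) -/

section Transfer

variable {n : ℕ}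

/-- The identification of the coordinate ring with functions of the vectors `ev_a`. -/
noncomputable def evHom (n : ℕ) : VecRing (Arrow n) →ₐ[ℂ] CoordRing n :=
  aeval fun p => evVec (generic n) p.1 p.2

/-- The inverse of `evHom`. -/
noncomputable def evInv (n : ℕ) : CoordRing n →ₐ[ℂ] VecRing (Arrow n) :=
  aeval fun p => Sum.elim (fun i => ![-X (Sum.inl i, 1), X (Sum.inl i, 0)] p.2)
    (fun i => X (Sum.inr i, p.2)) p.1

@[simp] theorem evHom_X (a : Arrow n) (k : Fin 2) :
    evHom n (X (a, k)) = evVec (generic n) a k := by simp [evHom]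

/-- The coordinate ring as the ring of functions of the vectors `ev_a`. -/
noncomputable def evEquiv (n : ℕ) : VecRing (Arrow n) ≃ₐ[ℂ] CoordRing n :=
  AlgEquiv.ofAlgHom (evHom n) (evInv n)
    (by
      refine algHom_ext fun ⟨a, k⟩ => ?_
      rcases a with a | a <;> fin_cases k <;> simp [evInv, evVec, generic])
    (by
      refine algHom_ext fun ⟨a, k⟩ => ?_
      rcases a with a | a <;> fin_cases k <;> simp [evInv, evVec, generic])

theorem evHom_bijective : Function.Bijective (evHom n) := (evEquiv n).bijective

theorem evHom_bracket (a b : Arrow n) : evHom n (bracket a b) = phi a b := by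
  simp [bracket_eq, phi, symp]

theorem map_bracketAlg : (bracketAlg (Arrow n)).map (evHom n) =
    Algebra.adjoin ℂ {f : CoordRing n | ∃ a b : Arrow n, f = phi a b} := by
  rw [bracketAlg, AlgHom.map_adjoin]
  congr 1
  ext f
  constructor
  · rintro ⟨_, ⟨p, rfl⟩, rfl⟩
    exact ⟨p.1, p.2, evHom_bracket _ _⟩
  · rintro ⟨a, b, rfl⟩
    exact ⟨_, ⟨(a, b), rfl⟩, evHom_bracket _ _⟩

theorem adjoin_le_invSL :
    Algebra.adjoin ℂ {f : CoordRing n | ∃ a b : Arrow n, f = phi a b} ≤ invSL n := by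
  refine Algebra.adjoin_le ?_
  rintro _ ⟨a, b, rfl⟩
  exact phi_mem_invSL a b

theorem evHom_mem_invSL {f : VecRing (Arrow n)} (hf : f ∈ bracketAlg (Arrow n)) :
    evHom n f ∈ invSL n := by
  refine adjoin_le_invSL ?_
  rw [← map_bracketAlg]
  exact ⟨f, hf, rfl⟩

/-- On the coordinates of `ev_a`, `h` acts through the matrix `h⁻¹`. As `pol i j` replaces
coordinate `j` by coordinate `i`, `h` is the inverse of the transvection at `(j, i)`. -/
theorem exists_coordAct_evHom {i j : Fin 2} (hij : i ≠ j) (t : ℂ) :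
    ∃ h : Matrix.SpecialLinearGroup (Fin 2) ℂ, ∀ f : VecRing (Arrow n),
      coordAct (slIncl n h) (evHom n f) = evHom n ((shear i j f).eval (C t)) := by
  let g : Matrix.SpecialLinearGroup (Fin 2) ℂ :=
    ⟨Matrix.transvection j i t, Matrix.det_transvection_of_ne _ _ hij.symm _⟩
  refine ⟨g⁻¹, fun f => ?_⟩
  let ev : Polynomial (VecRing (Arrow n)) →ₐ[ℂ] VecRing (Arrow n) :=
    (Polynomial.aeval (C t : VecRing (Arrow n))).restrictScalars ℂ
  have h : (coordAct (slIncl n g⁻¹)).comp (evHom n) =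
      (evHom n).comp (ev.comp (shear i j)) := by
    refine algHom_ext fun ⟨a, k⟩ => ?_
    have e1 : ev (shear i j (X (a, k))) = X (a, k) + C t * pol i j (X (a, k)) := by
      simp [ev, shear, mul_comm (C t)]
    rw [AlgHom.comp_apply, AlgHom.comp_apply, AlgHom.comp_apply, e1, evHom_X, coordAct_evVec,
      inv_inv, pol_X]
    have hC (c : ℂ) : evHom n (C c) = C c := (evHom n).commutes c
    simp only [g, Matrix.transvection, Matrix.add_apply, Matrix.one_apply, Matrix.single_apply,
      Fin.sum_univ_two, map_add, map_mul, hC, evHom_X]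
    fin_cases i <;> fin_cases j <;> simp at hij <;> (fin_cases k <;> simp <;> ring)
  have := DFunLike.congr_fun h f
  simpa [ev, Polynomial.aeval_def] using this

/-- Identifying `V_0^*` with `V_0` permutes the entries of the central equation up to sign and turns
the scalar matrix `λ_0` into a multiple of `ω`; hence `c = -λ_0`. -/
theorem map_fibreIdeal (lam : Fin (n + 1) → ℂ) :
    (fibreIdeal (A := Arrow n) Sum.inl Sum.inr (-lam 0) fun i : Fin n => lam i.succ).map
      (evHom n) = momentIdeal n lam := by
  have hC (c : ℂ) : evHom n (C c) = C c := (evHom n).commutes c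
  have h00 : evHom n (momentForm (A := Arrow n) Sum.inl Sum.inr (-lam 0) 0 0) =
      centralDefect n lam 0 1 := by
    simp [momentForm, centralDefect, momentCentral, Matrix.sum_apply, Matrix.mul_apply, evVec,
      mul_comm]
  have h01 : evHom n (momentForm (A := Arrow n) Sum.inl Sum.inr (-lam 0) 0 1) =
      centralDefect n lam 1 1 := by
    simp [momentForm, centralDefect, momentCentral, Matrix.sum_apply, Matrix.mul_apply, evVec, hC,
      mul_comm, sub_eq_add_neg]
  have h10 : evHom n (momentForm (A := Arrow n) Sum.inl Sum.inr (-lam 0) 1 0) =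
      -centralDefect n lam 0 0 := by
    simp [momentForm, centralDefect, momentCentral, Matrix.sum_apply, Matrix.mul_apply, evVec, hC,
      mul_comm, neg_add_eq_sub]
  have h11 : evHom n (momentForm (A := Arrow n) Sum.inl Sum.inr (-lam 0) 1 1) =
      -centralDefect n lam 1 0 := by
    simp [momentForm, centralDefect, momentCentral, Matrix.sum_apply, Matrix.mul_apply, evVec,
      mul_comm]
  have he (i : Fin n) : evHom n (bracket (Sum.inl i : Arrow n) (Sum.inr i) + C (lam i.succ)) =
      -externalDefect n lam i 0 0 := by
    rw [map_add, evHom_bracket, phi, symp_evVec_inl, hC]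
    simp [externalDefect, momentExternal, Matrix.mul_apply, Matrix.mulVec, dotProduct, evVec]
    ring
  refine le_antisymm (Ideal.map_le_iff_le_comap.2 (sup_le ?_ ?_)) ?_
  · rw [Ideal.span_le]
    rintro _ ⟨⟨k, l⟩, rfl⟩
    have hc (k l) : centralDefect n lam k l ∈ momentIdeal n lam :=
      Ideal.subset_span (Or.inl ⟨k, l, rfl⟩)
    change evHom n _ ∈ momentIdeal n lam
    fin_cases k <;> fin_cases l
    · exact h00 ▸ hc 0 1
    · exact h01 ▸ hc 1 1
    · exact h10 ▸ neg_mem (hc 0 0)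
    · exact h11 ▸ neg_mem (hc 1 0)
  · rw [Ideal.span_le]
    rintro _ ⟨i, rfl⟩
    change evHom n _ ∈ momentIdeal n lam
    rw [he]
    exact neg_mem (Ideal.subset_span (Or.inr ⟨i, rfl⟩))
  · rw [momentIdeal, Ideal.span_le]
    rintro _ (⟨k, l, rfl⟩ | ⟨i, rfl⟩)
    · have hm (k l : Fin 2) := Ideal.mem_map_of_mem (evHom n)
        (Ideal.mem_sup_left (Ideal.subset_span ⟨(k, l), rfl⟩) :
          momentForm (A := Arrow n) Sum.inl Sum.inr (-lam 0) k l ∈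
            fibreIdeal (A := Arrow n) Sum.inl Sum.inr (-lam 0) fun i : Fin n => lam i.succ)
      fin_cases k <;> fin_cases l
      · exact neg_mem_iff.1 (h10 ▸ hm 1 0)
      · exact h00 ▸ hm 0 0
      · exact neg_mem_iff.1 (h11 ▸ hm 1 1)
      · exact h01 ▸ hm 0 1
    · refine neg_mem_iff.1 (he i ▸ Ideal.mem_map_of_mem (evHom n) ?_)
      exact Ideal.mem_sup_right (Ideal.subset_span ⟨i, rfl⟩)

theorem evHom_mem_momentIdeal {lam : Fin (n + 1) → ℂ} {f : VecRing (Arrow n)} :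
    evHom n f ∈ momentIdeal n lam ↔
      f ∈ fibreIdeal (A := Arrow n) Sum.inl Sum.inr (-lam 0) fun i : Fin n => lam i.succ := by
  conv_rhs => rw [← Ideal.comap_map_of_bijective (evHom n) evHom_bijective
    (I := fibreIdeal (A := Arrow n) Sum.inl Sum.inr (-lam 0) fun i : Fin n => lam i.succ),
    map_fibreIdeal]
  rfl

/-- Modulo the zero ideal, invariance under transvections makes the off-diagonal operators, hence
the Casimir operator, vanish on the function. -/
theorem adjoin_eq_invSL :
    Algebra.adjoin ℂ {f : CoordRing n | ∃ a b : Arrow n, f = phi a b} = invSL n := by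
  refine le_antisymm adjoin_le_invSL fun f hf => ?_
  obtain ⟨g, rfl⟩ := evHom_bijective.2 f
  rw [← map_bracketAlg]
  refine ⟨g, mem_bracketAlg_of_casimir_eq_zero ?_, rfl⟩
  have hpol (i j : Fin 2) (hij : i ≠ j) : pol i j g ∈ (⊥ : Ideal (VecRing (Arrow n))) := by
    refine pol_mem_of_shear_mem fun t => ?_
    obtain ⟨h, hh⟩ := exists_coordAct_evHom (n := n) hij t
    rw [Ideal.mem_bot, sub_eq_zero]
    exact evHom_bijective.1 ((hh g).symm.trans (mem_invSL.1 hf h))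
  exact Ideal.mem_bot.1 (casimir_mem_of_pol_mem (I := ⊥) (fun i j _ f hf => by simp_all) hpol)

theorem mem_bracketAlg_of_evHom_mem {f : VecRing (Arrow n)} (hf : evHom n f ∈ invSL n) :
    f ∈ bracketAlg (Arrow n) := by
  rw [← adjoin_eq_invSL, ← map_bracketAlg] at hf
  obtain ⟨g, hg, h⟩ := hf
  rwa [← evHom_bijective.1 h]

theorem ker_aeval_phi : RingHom.ker (MvPolynomial.aeval (R := ℂ)
    fun p : Arrow n × Arrow n => phi p.1 p.2) = pluckerIdeal n := by
  let w : Arrow n → ℕ := Sum.elim (fun i => i) fun i => n + i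
  have hw : Function.Injective w := by
    rintro (a | a) (b | b) h <;> simp [w] at h ⊢ <;> omega
  let inst : LinearOrder (Arrow n) := LinearOrder.lift' w hw
  have hmono : @StrictMono _ _ inst.toPreorder _ w := fun a b h => h
  have h := @ker_bracketHom (Arrow n) inst w hmono
  have e : MvPolynomial.aeval (R := ℂ) (fun p : Arrow n × Arrow n => phi p.1 p.2) =
      (evHom n).comp (bracketHom (Arrow n)) := by
    refine algHom_ext fun p => ?_
    simp [bracketHom, evHom_bracket]
  change _ = relIdeal (Arrow n)
  rw [← h, e]
  ext f
  rw [RingHom.mem_ker, RingHom.mem_ker, AlgHom.comp_apply, map_eq_zero_iff _ evHom_bijective.1]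

theorem fibreAct_mk (lam : Fin (n + 1) → ℂ) (g : GLv n) (f : CoordRing n) :
    fibreAct lam g (Ideal.Quotient.mk _ f) = Ideal.Quotient.mk _ (coordAct g f) := rfl

theorem exists_lift_of_mem_fibreInvSL {lam : Fin (n + 1) → ℂ} {r : FibreRing n lam}
    (hr : r ∈ fibreInvSL n lam) : ∃ g ∈ bracketAlg (Arrow n),
      r = Ideal.Quotient.mk _ (evHom n g) := by
  obtain ⟨F, rfl⟩ := Ideal.Quotient.mk_surjective r
  obtain ⟨f, rfl⟩ := evHom_bijective.2 F
  obtain ⟨g, hg, hfg⟩ := exists_mem_bracketAlg_sub_mem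
    (I := fibreIdeal (A := Arrow n) Sum.inl Sum.inr (-lam 0) fun i : Fin n => lam i.succ)
    (fun i j hij f hf => pol_mem_fibreIdeal _ _ _ _ hij hf) (f := f) (fun i j hij => by
      refine pol_mem_of_shear_mem fun t => ?_
      obtain ⟨h, hh⟩ := exists_coordAct_evHom (n := n) hij t
      rw [← evHom_mem_momentIdeal, map_sub, ← hh, ← Ideal.Quotient.eq]
      exact mem_fibreInvSL.1 hr h)
  refine ⟨g, hg, ?_⟩
  rw [Ideal.Quotient.eq, ← map_sub, evHom_mem_momentIdeal]
  exact hfg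

theorem restrictInv_surjective (lam : Fin (n + 1) → ℂ) :
    Function.Surjective (restrictInv n lam) := by
  rintro ⟨r, hr⟩
  obtain ⟨g, hg, rfl⟩ := exists_lift_of_mem_fibreInvSL hr
  exact ⟨⟨evHom n g, evHom_mem_invSL hg⟩, rfl⟩

theorem ker_restrictInv (lam : Fin (n + 1) → ℂ) (hlam : 2 * lam 0 + ∑ i : Fin n, lam i.succ = 0) :
    RingHom.ker (restrictInv n lam) = invMomentIdeal n lam := by
  -- The condition `λ · v = 0` is exactly the trace condition for `c = -λ_0`.
  have hd : ∑ i : Fin n, lam i.succ = 2 * (-lam 0) := by linear_combination hlam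
  have hC (c : ℂ) : evHom n (C c) = C c := (evHom n).commutes c
  have hker (f : invSL n) : f ∈ RingHom.ker (restrictInv n lam) ↔ f.1 ∈ momentIdeal n lam := by
    rw [RingHom.mem_ker, ← Ideal.Quotient.eq_zero_iff_mem, Subtype.ext_iff]
    rfl
  have gen1 (i : Fin n) : evHom n (bracket (Sum.inl i : Arrow n) (Sum.inr i) + C (lam i.succ)) =
      (phiInv (Sum.inl i) (Sum.inr i) + algebraMap ℂ (invSL n) (lam i.succ) : invSL n).1 := by
    rw [map_add, evHom_bracket, hC]
    rfl
  have gen2 (b c : Arrow n) : evHom n (∑ i : Fin n, bracket (Sum.inl i) b * bracket (Sum.inr i) c +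
        C (-lam 0) * bracket b c) =
      (∑ i, phiInv (Sum.inl i) b * phiInv (Sum.inr i) c - lam 0 • phiInv b c : invSL n).1 := by
    simp [evHom_bracket, hC, phiInv, smul_eq_C_mul, sub_eq_add_neg]
  refine le_antisymm (fun f hf => ?_) ?_
  · obtain ⟨g, hg⟩ := evHom_bijective.2 f.1
    have hg1 : g ∈ bracketAlg (Arrow n) := mem_bracketAlg_of_evHom_mem (hg ▸ f.2)
    have hg2 := mem_invRelations_of_mem_fibreIdeal (A := Arrow n) Sum.inl Sum.inr (-lam 0)
      (fun i : Fin n => lam i.succ) hd hg1 (evHom_mem_momentIdeal.1 (hg ▸ (hker f).1 hf))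
    have key : ∃ F ∈ invMomentIdeal n lam, F.1 = evHom n g := by
      clear hg hg1
      induction hg2 using Submodule.span_induction with
      | mem x hx =>
        rcases hx with ⟨i, rfl⟩ | ⟨⟨b, c⟩, rfl⟩
        · exact ⟨_, Ideal.subset_span (Or.inl ⟨i, rfl⟩), (gen1 i).symm⟩
        · exact ⟨_, Ideal.subset_span (Or.inr ⟨b, c, rfl⟩), (gen2 b c).symm⟩
      | zero => exact ⟨0, zero_mem _, by simp⟩
      | add x y _ _ hx hy =>
        obtain ⟨F, hF, hFx⟩ := hx
        obtain ⟨G, hG, hGy⟩ := hy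
        exact ⟨F + G, add_mem hF hG, by rw [map_add, ← hFx, ← hGy]; rfl⟩
      | smul r x _ hx =>
        obtain ⟨F, hF, hFx⟩ := hx
        refine ⟨⟨_, evHom_mem_invSL r.2⟩ * F, Ideal.mul_mem_left _ _ hF, ?_⟩
        rw [Subalgebra.smul_def, smul_eq_mul, map_mul, ← hFx]
        rfl
    obtain ⟨F, hF, hFg⟩ := key
    rwa [← Subtype.ext (hFg.trans hg)]
  · rw [invMomentIdeal, Ideal.span_le]
    rintro _ (⟨i, rfl⟩ | ⟨b, c, rfl⟩)
    · rw [SetLike.mem_coe, hker, ← gen1, evHom_mem_momentIdeal]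
      exact invRelations_le_fibreIdeal _ _ _ _ (Submodule.subset_span (Or.inl ⟨i, rfl⟩))
    · rw [SetLike.mem_coe, hker, ← gen2, evHom_mem_momentIdeal]
      exact invRelations_le_fibreIdeal _ _ _ _ (Submodule.subset_span (Or.inr ⟨(b, c), rfl⟩))

end Transfer

/-! ### Torus weights of monomials; proof of (iii) -/

section Torus

variable {n : ℕ}

/-- The scalar by which `g ∈ GL_v` acts on the arrow `a`, up to the action of `g_0⁻¹`. -/
noncomputable def arrowScalar (g : GLv n) : Arrow n → ℂ
  | Sum.inl i => ((g.2 i)⁻¹ : ℂˣ) * (g.1 : Matrix (Fin 2) (Fin 2) ℂ).det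
  | Sum.inr i => (g.2 i : ℂ)

/-- The identification of `V_0^*` with `V_0` is equivariant only up to the determinant, by which
`GL_2` scales `ω`; this is the extra factor at `a_i`. -/
theorem coordAct_evVec_general (g : GLv n) (a : Arrow n) (k : Fin 2) :
    coordAct g (evVec (generic n) a k) = C (arrowScalar g a) *
      ∑ l, C (((g.1⁻¹ : GL (Fin 2) ℂ) : Matrix (Fin 2) (Fin 2) ℂ) k l) *
        evVec (generic n) a l := by
  have hdet : (g.1 : Matrix (Fin 2) (Fin 2) ℂ).det ≠ 0 := g.1.det_ne_zero
  have hinv : (g.1 : Matrix (Fin 2) (Fin 2) ℂ).adjugate =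
      (g.1 : Matrix (Fin 2) (Fin 2) ℂ).det •
        ((g.1⁻¹ : GL (Fin 2) ℂ) : Matrix (Fin 2) (Fin 2) ℂ) := by
    rw [Matrix.coe_units_inv, Matrix.inv_def, Ring.inverse_eq_inv', smul_smul,
      mul_inv_cancel₀ hdet, one_smul]
  have hx (k l : Fin 2) : C ((g.1 : Matrix (Fin 2) (Fin 2) ℂ).adjugate k l) =
      (C (g.1 : Matrix (Fin 2) (Fin 2) ℂ).det *
        C (((g.1⁻¹ : GL (Fin 2) ℂ) : Matrix (Fin 2) (Fin 2) ℂ) k l) : CoordRing n) := by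
    rw [hinv, ← C_mul]
    rfl
  have h00 := hx 0 0
  have h01 := hx 0 1
  have h10 := hx 1 0
  have h11 := hx 1 1
  rw [Matrix.adjugate_fin_two] at h00 h01 h10 h11
  simp only [Matrix.of_apply, Matrix.cons_val', Matrix.cons_val_zero, Matrix.cons_val_one,
    Matrix.cons_val_fin_one, map_neg] at h00 h01 h10 h11
  have hX (p : Arrow n × Fin 2) : coordAct g (X p) = (act g⁻¹ (generic n)).coord p := by
    simp [coordAct]
  rcases a with i | i
  · have e0 : evVec (generic n) (Sum.inl i) 0 = X (Sum.inl i, 1) := rfl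
    have e1 : evVec (generic n) (Sum.inl i) 1 = -X (Sum.inl i, 0) := rfl
    have hB (k : Fin 2) : coordAct g (X (Sum.inl i, k)) =
        C (((g.2 i)⁻¹ : ℂˣ) : ℂ) * (X (Sum.inl i, 0) * C ((g.1 : Matrix (Fin 2) (Fin 2) ℂ) 0 k) +
          X (Sum.inl i, 1) * C ((g.1 : Matrix (Fin 2) (Fin 2) ℂ) 1 k)) := by
      rw [hX]
      simp only [QuiverRep.coord, act, Matrix.smul_apply, Matrix.mul_apply, Fin.sum_univ_two,
        smul_eq_C_mul, Prod.fst_inv, Prod.snd_inv, inv_inv, Pi.inv_apply]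
      rfl
    rw [Fin.sum_univ_two, e0, e1]
    simp only [arrowScalar, C_mul]
    obtain rfl | rfl : k = 0 ∨ k = 1 := by omega
    · change coordAct g (X (Sum.inl i, 1)) = _
      rw [hB]
      linear_combination C (((g.2 i)⁻¹ : ℂˣ) : ℂ) * (X (Sum.inl i, 1) * h00 -
        X (Sum.inl i, 0) * h01)
    · change coordAct g (-X (Sum.inl i, 0)) = _
      rw [map_neg, hB]
      linear_combination C (((g.2 i)⁻¹ : ℂˣ) : ℂ) * (X (Sum.inl i, 1) * h10 -
        X (Sum.inl i, 0) * h11)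
  · change coordAct g (X (Sum.inr i, k)) = _
    rw [hX]
    simp only [QuiverRep.coord, act, Matrix.smul_apply, Matrix.mul_apply,
      smul_eq_C_mul, Prod.fst_inv, Prod.snd_inv, inv_inv, Pi.inv_apply]
    rfl

/-- A square root of the determinant divides the factor of `ω` evenly between the two indices, so
the scalar on a monomial depends only on its occurrences. -/
theorem coordAct_phi (g : GLv n) {δ : ℂ} (hδ : δ ^ 2 = (g.1 : Matrix (Fin 2) (Fin 2) ℂ).det)
    (a b : Arrow n) :
    coordAct g (phi a b) = C (arrowScalar g a / δ * (arrowScalar g b / δ)) * phi a b := by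
  have h : ((g.1⁻¹ : GL (Fin 2) ℂ) : Matrix (Fin 2) (Fin 2) ℂ).det = (δ ^ 2)⁻¹ := by
    rw [hδ, Matrix.coe_units_inv, Matrix.det_nonsing_inv, Ring.inverse_eq_inv']
  rw [Matrix.det_fin_two] at h
  have hC := congrArg (C (σ := Arrow n × Fin 2)) h
  have hs : arrowScalar g a / δ * (arrowScalar g b / δ) =
      arrowScalar g a * arrowScalar g b * (δ ^ 2)⁻¹ := by
    rw [div_mul_div_comm, div_eq_mul_inv, pow_two]
  rw [hs, C_mul, C_mul, ← hC]
  simp only [phi, symp, map_sub, map_mul, coordAct_evVec_general, Fin.sum_univ_two]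
  ring

theorem coordAct_phiMonomial (g : GLv n) {χ : Arrow n → ℂ}
    (hχ : ∀ a b, coordAct g (phi a b) = C (χ a * χ b) * phi a b) (m : Arrow n × Arrow n →₀ ℕ) :
    coordAct g (phiMonomial m) = C (∏ a, χ a ^ occurrences m a) * phiMonomial m := by
  have h1 : phiMonomial m = ∏ p, phi p.1 p.2 ^ m p := Finsupp.prod_fintype _ _ (by simp)
  have h2 (a : Arrow n) : occurrences m a =
      ∑ p, m p * ((if p.1 = a then 1 else 0) + (if p.2 = a then 1 else 0)) :=
    Finsupp.sum_fintype _ _ (by simp)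
  have h3 : ∏ a, χ a ^ occurrences m a = ∏ p : Arrow n × Arrow n, (χ p.1 * χ p.2) ^ m p := by
    simp only [h2, ← Finset.prod_pow_eq_pow_sum]
    rw [Finset.prod_comm]
    refine Finset.prod_congr rfl fun p _ => ?_
    simp only [mul_comm (m p), pow_mul, Finset.prod_pow, pow_add, Finset.prod_mul_distrib]
    congr 2 <;> simp [pow_ite, Finset.prod_ite_eq]
  rw [h3, h1, map_prod, map_prod, ← Finset.prod_mul_distrib]
  refine Finset.prod_congr rfl fun p _ => ?_
  rw [map_pow, hχ, mul_pow, C_pow]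

/-- The scalars of `a_i` and `a_i^*` multiply to `det g_0 = δ²`, so after division by `δ` they are
mutually inverse. -/
theorem coordAct_phiMonomial_of_balanced (g : GLv n) {m : Arrow n × Arrow n →₀ ℕ}
    (hm : ∀ i : Fin n, occurrences m (Sum.inl i) = occurrences m (Sum.inr i)) :
    coordAct g (phiMonomial m) = phiMonomial m := by
  have hdet : (g.1 : Matrix (Fin 2) (Fin 2) ℂ).det ≠ 0 := g.1.det_ne_zero
  obtain ⟨δ, hδ⟩ := IsAlgClosed.exists_pow_nat_eq (g.1 : Matrix (Fin 2) (Fin 2) ℂ).det two_pos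
  have hδ0 : δ ≠ 0 := by
    rintro rfl
    exact hdet (by rw [← hδ]; simp)
  rw [coordAct_phiMonomial g (χ := fun a => arrowScalar g a / δ) (coordAct_phi g hδ),
    Fintype.prod_sum_type, ← Finset.prod_mul_distrib, Finset.prod_eq_one, C_1, one_mul]
  intro i _
  rw [hm, ← mul_pow]
  have : arrowScalar g (Sum.inl i) / δ * (arrowScalar g (Sum.inr i) / δ) = 1 := by
    simp only [arrowScalar, ← hδ, Units.val_inv_eq_inv_val]
    have := (g.2 i).ne_zero
    field_simp
  rw [this, one_pow]

/-- The character by which the torus `(ℂ^×)^n` acts on an arrow. -/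
noncomputable def arrowChar (n : ℕ) : Arrow n → ((Fin n → ℂˣ) →* ℂ)
  | Sum.inl i => (Units.coeHom ℂ).comp (Pi.evalMonoidHom _ i)⁻¹
  | Sum.inr i => (Units.coeHom ℂ).comp (Pi.evalMonoidHom _ i)

/-- The character by which the torus `(ℂ^×)^n` acts on a monomial. -/
noncomputable def monomialChar (m : Arrow n × Arrow n →₀ ℕ) : (Fin n → ℂˣ) →* ℂ :=
  ∏ a, arrowChar n a ^ occurrences m a

theorem coordAct_torus_phiMonomial (t : Fin n → ℂˣ) (m : Arrow n × Arrow n →₀ ℕ) :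
    coordAct (1, t) (phiMonomial m) = C (monomialChar m t) * phiMonomial m := by
  have h (a : Arrow n) : arrowScalar ((1, t) : GLv n) a = arrowChar n a t := by
    rcases a with i | i
    · simp [arrowScalar, arrowChar]
    · simp [arrowScalar, arrowChar]
  rw [coordAct_phiMonomial (1, t) (χ := fun a => arrowChar n a t), monomialChar]
  · simp
  · intro a b
    rw [coordAct_phi (1, t) (δ := 1) (by simp), h, h, div_one, div_one]

theorem balanced_of_monomialChar_eq_one {m : Arrow n × Arrow n →₀ ℕ} (hm : monomialChar m = 1)
    (i : Fin n) : occurrences m (Sum.inl i) = occurrences m (Sum.inr i) := by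
  classical
  -- The torus point with `2` in place `i` and `1` elsewhere suffices, since the powers of `2` are
  -- distinct.
  let two : ℂˣ := Units.mk0 2 two_ne_zero
  have h := DFunLike.congr_fun hm (Pi.mulSingle i two)
  rw [monomialChar, MonoidHom.finsetProd_apply, Fintype.prod_sum_type,
    Finset.prod_eq_single_of_mem i (Finset.mem_univ i),
    Finset.prod_eq_single_of_mem i (Finset.mem_univ i)] at h
  · simp only [arrowChar, MonoidHom.pow_apply, MonoidHom.comp_apply, MonoidHom.inv_apply,
      Pi.evalMonoidHom_apply, Pi.mulSingle_eq_same, Units.coeHom_apply, MonoidHom.one_apply, two,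
      Units.val_inv_eq_inv_val, Units.val_mk0, inv_pow] at h
    rw [inv_mul_eq_one₀ (pow_ne_zero _ two_ne_zero)] at h
    have h' : (2 : ℕ) ^ occurrences m (Sum.inl i) = 2 ^ occurrences m (Sum.inr i) := by
      exact_mod_cast h
    exact Nat.pow_right_injective le_rfl h'
  · intro j _ hj
    simp [arrowChar, hj]
  · intro j _ hj
    simp [arrowChar, hj]

theorem exists_sum_phiMonomial {f : CoordRing n} (hf : f ∈ invSL n) :
    ∃ P : MvPolynomial (Arrow n × Arrow n) ℂ, f = ∑ m ∈ P.support, P.coeff m • phiMonomial m := by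
  have hset : {f : CoordRing n | ∃ a b : Arrow n, f = phi a b} =
      Set.range fun p : Arrow n × Arrow n => phi p.1 p.2 := by
    ext f
    exact ⟨fun ⟨a, b, h⟩ => ⟨(a, b), h.symm⟩, fun ⟨p, h⟩ => ⟨p.1, p.2, h.symm⟩⟩
  rw [← adjoin_eq_invSL, hset, Algebra.adjoin_range_eq_range_aeval] at hf
  obtain ⟨P, rfl⟩ := hf
  refine ⟨P, ?_⟩
  conv_lhs => rw [P.as_sum]
  rw [map_sum]
  refine Finset.sum_congr rfl fun m _ => ?_
  change aeval _ (monomial m (P.coeff m)) = _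
  rw [aeval_monomial, phiMonomial, Algebra.smul_def]

theorem fibreInvGL_eq_span (lam : Fin (n + 1) → ℂ) :
    Subalgebra.toSubmodule (fibreInvGL n lam) =
      Submodule.span ℂ {r : FibreRing n lam | ∃ m : Arrow n × Arrow n →₀ ℕ,
        (∀ i : Fin n, occurrences m (Sum.inl i) = occurrences m (Sum.inr i)) ∧
          r = Ideal.Quotient.mk (momentIdeal n lam) (phiMonomial m)} := by
  classical
  have hmem (r : FibreRing n lam) : r ∈ fibreInvGL n lam ↔ ∀ g, fibreAct lam g r = r := by
    simp [fibreInvGL, Algebra.mem_iInf, AlgHom.mem_equalizer]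
  refine le_antisymm (fun r hr => ?_) (Submodule.span_le.2 ?_)
  · have hr' := (hmem r).1 hr
    obtain ⟨g, hg, rfl⟩ := exists_lift_of_mem_fibreInvSL
      (mem_fibreInvSL.2 fun h => hr' (slIncl n h))
    obtain ⟨P, hP⟩ := exists_sum_phiMonomial (evHom_mem_invSL hg)
    by_contra hnot
    -- A functional that kills the balanced monomials but not `r` turns invariance in the quotient
    -- into a scalar identity between characters.
    obtain ⟨l, hl, hW⟩ := Submodule.exists_le_ker_of_notMem hnot
    let L : CoordRing n →ₗ[ℂ] ℂ := l ∘ₗ (Ideal.Quotient.mkₐ ℂ (momentIdeal n lam)).toLinearMap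
    have hLt (t : Fin n → ℂˣ) : ∑ m ∈ P.support, P.coeff m * L (phiMonomial m) * monomialChar m t =
        L (evHom n g) := by
      have h := hr' (1, t)
      rw [fibreAct_mk] at h
      have h' : L (coordAct (1, t) (evHom n g)) = L (evHom n g) := congrArg l h
      rw [← h', hP, map_sum, map_sum]
      refine Finset.sum_congr rfl fun m _ => ?_
      rw [map_smul, coordAct_torus_phiMonomial, ← smul_eq_C_mul, map_smul, map_smul, smul_eq_mul,
        smul_eq_mul]
      ring
    let F : ((Fin n → ℂˣ) →* ℂ) →₀ ℂ := ∑ m ∈ P.support,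
      Finsupp.single (monomialChar m) (P.coeff m * L (phiMonomial m)) -
        Finsupp.single 1 (L (evHom n g))
    have hF : F = 0 := by
      refine (linearIndependent_iff.1 (linearIndependent_monoidHom (Fin n → ℂˣ) ℂ)) F ?_
      funext t
      simp only [F, map_sub, map_sum, Finsupp.linearCombination_single, Pi.sub_apply,
        Finset.sum_apply, Pi.smul_apply, smul_eq_mul, MonoidHom.one_apply, mul_one, hLt, sub_self,
        Pi.zero_apply]
    -- At the trivial character only monomials of trivial weight contribute; they are balanced, so
    -- `L` kills them, forcing `L (evHom n g) = 0`.
    have h1 := DFunLike.congr_fun hF 1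
    simp only [F, Finsupp.sub_apply, Finsupp.finsetSum_apply, Finsupp.single_apply, if_true,
      Finsupp.zero_apply] at h1
    rw [Finset.sum_eq_zero, zero_sub, neg_eq_zero] at h1
    · exact hl h1
    · intro m _
      split_ifs with hm
      · have : L (phiMonomial m) = 0 :=
          hW (Submodule.subset_span ⟨m, balanced_of_monomialChar_eq_one hm, rfl⟩)
        rw [this, mul_zero]
      · rfl
  · rintro _ ⟨m, hm, rfl⟩
    refine (hmem _).2 fun g => ?_
    rw [fibreAct_mk, coordAct_phiMonomial_of_balanced g hm]

end Torus

end Hyperpolygon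

open Hyperpolygon
theorem proposition2p8 (n : ℕ) (lam : Fin (n + 1) → ℂ)
    (hlam : 2 * lam 0 + ∑ i : Fin n, lam i.succ = 0) :
    (Algebra.adjoin ℂ {f : CoordRing n | ∃ a b : Arrow n, f = phi a b} = invSL n ∧
      RingHom.ker (MvPolynomial.aeval (R := ℂ) fun p : Arrow n × Arrow n => phi p.1 p.2) =
        pluckerIdeal n) ∧
    (Function.Surjective (restrictInv n lam) ∧
      RingHom.ker (restrictInv n lam) = invMomentIdeal n lam) ∧
    Subalgebra.toSubmodule (fibreInvGL n lam) =
      Submodule.span ℂ {r : FibreRing n lam | ∃ m : Arrow n × Arrow n →₀ ℕ,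
        (∀ i : Fin n, occurrences m (Sum.inl i) = occurrences m (Sum.inr i)) ∧
          r = Ideal.Quotient.mk (momentIdeal n lam) (phiMonomial m)} :=
  ⟨⟨adjoin_eq_invSL, ker_aeval_phi⟩,
    ⟨restrictInv_surjective lam, ker_restrictInv lam hlam⟩, fibreInvGL_eq_span lam⟩
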